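/- All graphs are finite, simple and undirected; a tree is subcubic if every vertex has at most three neighbours. A subdivision of a graph is obtained by replacing its edges by internally disjoint paths of nonzero length. In the blind cops and robber game of radius $r\in\mathbb N$ on a graph $G$, the cops choose vertex sets $C_1,\dots,C_m\subseteq V(G)$ in advance. The possible positions of the robber are $A_1=V(G)\setminus C_1$ and, for $1\le i<m$, $A_{i+1}$ is the set of all $u\in V(G)\setminus C_{i+1}$ such that $G\setminus(C_i\cap C_{i+1})$ has a path of length at most $r$ from a vertex of $A_i$ to $u$. The cops win if $A_m=\emptyset$. The radius-$r$ blind cop-width $\mathrm{bcw}_r(G)$ is the least $k$ such that the cops can win with $|C_i|\le k$ for all $i$. A $k$-flip of $G$ is given by a partition $\mathcal P$ of $V(G)$ into at most $k$ parts and a graph $F$ on $\mathcal P$, possibly with loops; it exchanges adjacency and non-adjacency of all pairs of distinct vertices $u\in P$, $v\in Q$ with $\{P,Q\}\in E(F)$. In the blind flipper game of radius $r$ on $G=G_0$, the flipper fixes in advance a sequence $G_1,\dots,G_m$ of $k$-flips of $G$. In round $i$ the robber moves along a path of length at most $r$ in $G_{i-1}$, after which the graph becomes $G_i$; he loses if,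 for some $i\ge 0$, he is at an isolated vertex of $G_i$ (for $i=0$, at the start of the game). The radius-$r$ blind flip-width $\mathrm{bfw}_r(G)$ is the least $k$ for which the flipper has such a sequence against which every robber loses. The linear clique-width of $G$ is the least number of labels with which $G$ can be built by the operations: add one new labelled vertex; add all edges between the vertices of label $i$ and those of label $j\ne i$; change all labels $i$ to $j$. A class $\mathscr C$ of graphs has bounded blind cop-width (respectively, bounded blind flip-width) if there is a function $f:\mathbb N\to\mathbb N$ such that $\mathrm{bcw}_r(G)\le f(r)$ (respectively, $\mathrm{bfw}_r(G)\le f(r)$) for all $r\in\mathbb N$ and all $G\in\mathscr C$. Toru\'nczyk conjectured that a class of graphs has bounded blind flip-width if and only if it has bounded linear clique-width. \textbf{Theorem.} There is a class $\mathscr C$ of subcubic trees, each of them a subdivision of a complete binary tree, such that $\mathscr C$ has bounded radius-$r$ blind cop-width for every $r\in\mathbb N$ and unbounded pathwidth, and such that $\mathscr C$ has bounded blind flip-width and unbounded linear clique-width. Consequently, Toru\'nczyk's conjecture is false. -/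

import Mathlib

namespace BlindPursuit

/-- A finite simple graph, bundled with its vertex type. A class of graphs is a set of these. -/
structure FinGraph where
  /-- the vertex set -/
  V : Type
  /-- the vertex set is finite -/
  [fintypeV : Fintype V]
  /-- the adjacency structure -/
  graph : SimpleGraph V

section Graphs

variable {V W : Type*}

/-- Every vertex has at most three neighbours. -/
def IsSubcubic (G : SimpleGraph V) : Prop :=
  ∀ v, (G.neighborSet v).encard ≤ 3

/-- The complete binary tree of height `h`: its nodes are the binary words of length at most `h`,
the root is the empty word, and the children of a word `w` are `false :: w` and `true :: w`. -/
def completeBinaryTree (h : ℕ) : SimpleGraph {w : List Bool // w.length ≤ h} where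
  Adj x y := (∃ b, y.1 = b :: x.1) ∨ (∃ b, x.1 = b :: y.1)
  symm := ⟨fun _ _ hxy => hxy.symm⟩
  loopless := ⟨fun x hx => by
    rcases hx with ⟨b, hb⟩ | ⟨b, hb⟩ <;> simpa using congrArg List.length hb⟩

/-- `H` is a subdivision of `G`: it arises by replacing the edges of `G` by internally disjoint
paths of nonzero length. The vertex `u` of `G` becomes the vertex `f u` of `H`, and the edge `uv` of
`G` becomes the path `P u v _` of `H` (read backwards, it is `P v u _`); its length is nonzero
because its ends are distinct. -/
def IsSubdivision (H : SimpleGraph W) (G : SimpleGraph V) : Prop :=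
  ∃ (f : V → W) (P : ∀ u v, G.Adj u v → H.Walk (f u) (f v)),
    Function.Injective f ∧
    (∀ u v h, (P u v h).IsPath) ∧
    (∀ u v (h : G.Adj u v), P v u h.symm = (P u v h).reverse) ∧
    -- an original vertex lies on the path of an edge only as an end of it
    (∀ u v h w, f w ∈ (P u v h).support → w = u ∨ w = v) ∧
    -- the paths of two different edges share no vertices other than original ones
    (∀ u v h u' v' h' x, s(u, v) ≠ s(u', v') →
      x ∈ (P u v h).support → x ∈ (P u' v' h').support → x ∈ Set.range f) ∧
    -- `H` has no further vertices and no further edges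
    (∀ x, x ∈ Set.range f ∨ ∃ u v h, x ∈ (P u v h).support) ∧
    (∀ e ∈ H.edgeSet, ∃ u v h, e ∈ (P u v h).edges)

/-! ### Pathwidth -/

/-- A path decomposition of `G` along the path with nodes `0, …, m`: the bags cover all vertices and
all edges, and the nodes whose bags contain a given vertex form a subpath. -/
structure PathDecomposition (G : SimpleGraph V) where
  /-- the last node of the path -/
  m : ℕ
  /-- the bags -/
  bag : Fin (m + 1) → Finset V
  cover_vertex : ∀ v, ∃ i, v ∈ bag i
  cover_edge : ∀ u v, G.Adj u v → ∃ i, u ∈ bag i ∧ v ∈ bag i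
  connected : ∀ v, {i | v ∈ bag i}.OrdConnected

/-- The pathwidth: the least `w` for which some path decomposition has all bags of size at most
`w + 1`. -/
noncomputable def pathwidth (G : SimpleGraph V) : ℕ∞ :=
  ⨅ (w : ℕ) (_ : ∃ D : PathDecomposition G, ∀ i, (D.bag i).card ≤ w + 1), (w : ℕ∞)

/-! ### Linear clique-width -/

/-- The pairs of vertices of `S` with labels `i` and `j`, as edges. -/
def joinEdges {k : ℕ} (S : Set V) (lab : V → Fin k) (i j : Fin k) : SimpleGraph V :=
  SimpleGraph.fromRel fun u v => u ∈ S ∧ v ∈ S ∧ lab u = i ∧ lab v = j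

open Classical in
/-- `LinearlyBuilt k S H lab`: the graph with vertex set `S` and the edges of `H`, in which `v ∈ S`
has label `lab v`, can be built with `k` labels by the operations of linear clique-width
expressions. Values of `lab` outside `S` are irrelevant. -/
inductive LinearlyBuilt (k : ℕ) : Set V → SimpleGraph V → (V → Fin k) → Prop
  /-- start without vertices -/
  | empty (lab : V → Fin k) : LinearlyBuilt k ∅ ⊥ lab
  /-- disjoint union with one new vertex `v`, of label `i` -/
  | addVertex {S : Set V} {H : SimpleGraph V} {lab : V → Fin k} (v : V) (i : Fin k) (hv : v ∉ S) :
      LinearlyBuilt k S H lab → LinearlyBuilt k (insert v S) H (Function.update lab v i)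
  /-- add all edges between the vertices of label `i` and those of label `j ≠ i` -/
  | join {S : Set V} {H : SimpleGraph V} {lab : V → Fin k} (i j : Fin k) (hij : i ≠ j) :
      LinearlyBuilt k S H lab → LinearlyBuilt k S (H ⊔ joinEdges S lab i j) lab
  /-- change all labels `i` to `j` -/
  | relabel {S : Set V} {H : SimpleGraph V} {lab : V → Fin k} (i j : Fin k) :
      LinearlyBuilt k S H lab → LinearlyBuilt k S H (fun v => if lab v = i then j else lab v)

/-- The linear clique-width: the least number of labels with which `G` can be built linearly. -/
noncomputable def linearCliqueWidth (G : SimpleGraph V) : ℕ∞ :=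
  ⨅ (k : ℕ) (_ : ∃ lab : V → Fin k, LinearlyBuilt k Set.univ G lab), (k : ℕ∞)

/-! ### The blind cops and robber game -/

/-- The ends of the paths of length at most `r` in `G` without the vertices in `X` that start
in `A`. -/
def spread (G : SimpleGraph V) (r : ℕ) (X A : Set V) : Set V :=
  {u | ∃ a ∈ A, ∃ p : G.Walk a u, p.IsPath ∧ p.length ≤ r ∧ ∀ x ∈ p.support, x ∉ X}

/-- The possible positions of an unseen robber of speed `r` when the cops occupy
`C 0, C 1, C 2, …` in turn. -/
def copTerritory (G : SimpleGraph V) (r : ℕ) (C : ℕ → Finset V) : ℕ → Set V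
  | 0 => {u | u ∉ C 0}
  | i + 1 => {u | u ∉ C (i + 1)} ∩
      spread G r {x | x ∈ C i ∧ x ∈ C (i + 1)} (copTerritory G r C i)

/-- The radius-`r` blind cop-width: the least number of cops with a sequence of positions after
finitely many turns of which the robber cannot be anywhere. -/
noncomputable def blindCopWidth (r : ℕ) (G : SimpleGraph V) : ℕ∞ :=
  ⨅ (k : ℕ) (_ : ∃ C : ℕ → Finset V, (∀ i, (C i).card ≤ k) ∧ ∃ m, copTerritory G r C m = ∅),
    (k : ℕ∞)

/-! ### The blind flipper game -/

/-- The data of a `k`-flip: a partition of `V` into at most `k` parts (the nonempty fibres of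
`part`), and a graph `F`, with loops allowed, on the parts. -/
structure FlipData (V : Type*) (k : ℕ) where
  /-- the part of a vertex -/
  part : V → Fin k
  /-- adjacency of parts -/
  F : Fin k → Fin k → Prop
  symm : ∀ i j, F i j → F j i

/-- The graph obtained from `G` by exchanging adjacency and non-adjacency between distinct vertices
whose parts are adjacent in `F`. -/
def flip {k : ℕ} (G : SimpleGraph V) (φ : FlipData V k) : SimpleGraph V where
  Adj u v := u ≠ v ∧ ((G.Adj u v ∧ ¬ φ.F (φ.part u) (φ.part v)) ∨
    (¬ G.Adj u v ∧ φ.F (φ.part u) (φ.part v)))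
  symm := ⟨fun u v ⟨hne, h⟩ => ⟨hne.symm, by
    have hF : φ.F (φ.part v) (φ.part u) ↔ φ.F (φ.part u) (φ.part v) := ⟨φ.symm _ _, φ.symm _ _⟩
    rw [hF, G.adj_comm v u]; exact h⟩⟩
  loopless := ⟨fun _ h => h.1 rfl⟩

/-- The graphs `G_0 = G, G_1, G_2, …` of the game; every flip is applied to `G` itself. -/
def flipGraph {k : ℕ} (G : SimpleGraph V) (φ : ℕ → FlipData V k) : ℕ → SimpleGraph V
  | 0 => G
  | i + 1 => flip G (φ i)

/-- The possible positions after round `i` of an unseen robber of speed `r` who has not yet lost: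
in round `i + 1` he moves in `G_i`, and he loses when he is at an isolated vertex of the next graph
`G_{i+1}` (or of `G_0` at the start). -/
def flipTerritory {k : ℕ} (G : SimpleGraph V) (r : ℕ) (φ : ℕ → FlipData V k) : ℕ → Set V
  | 0 => {v | ¬ G.IsIsolated v}
  | i + 1 => {v | ¬ (flipGraph G φ (i + 1)).IsIsolated v} ∩
      spread (flipGraph G φ i) r ∅ (flipTerritory G r φ i)

/-- The radius-`r` blind flip-width: the least `k` for which some sequence of `k`-flips, fixed in
advance, makes every robber lose within finitely many rounds. -/
noncomputable def blindFlipWidth (r : ℕ) (G : SimpleGraph V) : ℕ∞ :=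
  ⨅ (k : ℕ) (_ : ∃ φ : ℕ → FlipData V k, ∃ m, flipTerritory G r φ m = ∅), (k : ℕ∞)

end Graphs

/-! ### Boundedness on classes of graphs -/

/-- For every finite radius `r`, the radius-`r` blind cop-width is bounded on the class. -/
def BoundedBlindCopWidth (𝒞 : Set FinGraph) : Prop :=
  ∃ f : ℕ → ℕ, ∀ r, ∀ G ∈ 𝒞, blindCopWidth r G.graph ≤ f r

/-- For every finite radius `r`, the radius-`r` blind flip-width is bounded on the class. -/
def BoundedBlindFlipWidth (𝒞 : Set FinGraph) : Prop :=
  ∃ f : ℕ → ℕ, ∀ r, ∀ G ∈ 𝒞, blindFlipWidth r G.graph ≤ f r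

/-- The pathwidth is bounded on the class. -/
def BoundedPathwidth (𝒞 : Set FinGraph) : Prop :=
  ∃ k : ℕ, ∀ G ∈ 𝒞, pathwidth G.graph ≤ k

/-- The linear clique-width is bounded on the class. -/
def BoundedLinearCliqueWidth (𝒞 : Set FinGraph) : Prop :=
  ∃ k : ℕ, ∀ G ∈ 𝒞, linearCliqueWidth G.graph ≤ k

/-- Toruńczyk's conjecture: a class of graphs has bounded blind flip-width if and only if it has
bounded linear clique-width. -/
def TorunczykConjecture : Prop :=
  ∀ 𝒞 : Set FinGraph, BoundedBlindFlipWidth 𝒞 ↔ BoundedLinearCliqueWidth 𝒞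

end BlindPursuit

/-!
The class consists of one tree for every `n`: the complete binary tree of height `n`, in which the
edges are replaced by paths whose lengths grow very fast towards the root.

*Few blind cops suffice.* On such a tree four cops catch an unseen robber of any speed `r ≤ n`
(`exists_subdivision_strategy`). To clear a path without branching, two cops guard its ends while two
others sweep it. For a node `w`, suppose that the robber is known not to be on the path above `w`.
Since this path is long and his speed is bounded, it takes him a long time to come down to `w`, and
so the cops may clear the subtree below `w` without a guard on `w`. This subtree is cleared
recursively: the path to the first child, the subtree of this child, and the path again; then the
part of the path above `w` that the robber may have entered from the second child; and then the path
to the second child, the subtree of the second child, and the path again (`clearable_node`). All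
guards are removed before a recursive call, and so the number of cops does not grow with the height.
For a fixed speed, the finitely many trees with `n < r` only change the bound. A flip can isolate a
bounded number of vertices, so that the strategy of the cops carries over to the blind flipper game
(`exists_flip_strategy`).

*Pathwidth and linear clique-width are unbounded.* Among three disjoint subtrees with a large bag
each, the large bag that comes second also meets the connection between the two other subtrees
(`le_encard_bag_of_three_subtrees`); so the size of the largest bag grows with the height
(`exists_le_encard_bag`). In a linear clique-width construction, vertices with the same label get the
same neighbours among the vertices that are added later, and in a subcubic graph at most three
vertices can share a neighbour. Thus a construction with `k` labels gives a path decomposition with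
bags of size at most `3 * k + 1` (`LinearlyBuilt.exists_bags`).

The vertices of the trees are encoded as words: adjacent words differ by one letter at the front, and
the ancestors of a word are its suffixes.
-/

namespace BlindPursuit

section Trees

variable {L : ℕ → ℕ} {h : ℕ}

/-! ### Expanded words -/

/-- The word that describes the node `x` of a complete binary tree after subdivision, when each edge
below a node of depth `k` is replaced by a path of length `L k + 1`. Its proper suffixes are the
proper ancestors of the node in the subdivided tree; the first step below a branching records the
child that is chosen, and the remaining steps along a path are `false`. -/
def expand (L : ℕ → ℕ) : List Bool → List Bool
  | [] => []
  | b :: x => List.replicate (L x.length) false ++ b :: expand L x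

lemma length_expand_cons (b : Bool) (x : List Bool) :
    (expand L (b :: x)).length = (expand L x).length + L x.length + 1 := by
  simp [expand]; omega

lemma cons_expand_suffix (b : Bool) (x : List Bool) : b :: expand L x <:+ expand L (b :: x) :=
  List.suffix_append _ _

lemma expand_suffix_expand_cons (b : Bool) (x : List Bool) : expand L x <:+ expand L (b :: x) :=
  (List.suffix_cons _ _).trans (cons_expand_suffix b x)

lemma expand_suffix_expand {x y : List Bool} (h : x <:+ y) : expand L x <:+ expand L y := by
  induction y with
  | nil => rw [List.suffix_nil] at h; rw [h]
  | cons b y ih =>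
    rcases List.suffix_cons_iff.1 h with rfl | h
    · exact List.suffix_rfl
    · exact (ih h).trans (expand_suffix_expand_cons b y)

lemma length_expand_eq {x y : List Bool} (h : x.length = y.length) :
    (expand L x).length = (expand L y).length := by
  induction x generalizing y with
  | nil => rw [List.length_eq_zero_iff.1 h.symm]
  | cons b x ih =>
    cases y with
    | nil => simp at h
    | cons c y =>
      have h' : x.length = y.length := by simpa using h
      rw [length_expand_cons, length_expand_cons, ih h', h']

lemma length_expand_lt {x y : List Bool} (h : x.length < y.length) :
    (expand L x).length < (expand L y).length := by
  induction y with
  | nil => simp at h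
  | cons b y ih =>
    rw [length_expand_cons]
    rcases Nat.lt_succ_iff_lt_or_eq.1 (show x.length < y.length + 1 by simpa using h) with h | h
    · have := ih h; omega
    · have := length_expand_eq (L := L) h; omega

lemma length_expand_lt_iff {x y : List Bool} :
    (expand L x).length < (expand L y).length ↔ x.length < y.length := by
  refine ⟨fun h => ?_, length_expand_lt⟩
  by_contra! h'
  rcases h'.eq_or_lt with h' | h'
  · have := length_expand_eq (L := L) h'; omega
  · have := length_expand_lt (L := L) h'; omega

lemma expand_injective : Function.Injective (expand L) := by
  intro x
  induction x with
  | nil =>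
    intro y h
    cases y with
    | nil => rfl
    | cons c y => simp [expand] at h
  | cons b x ih =>
    intro y h
    have hl : (b :: x).length = y.length := by
      have := congrArg List.length h
      rcases lt_trichotomy (b :: x).length y.length with h' | h' | h'
      · have := length_expand_lt (L := L) h'; omega
      · exact h'
      · have := length_expand_lt (L := L) h'; omega
    cases y with
    | nil => simp at hl
    | cons c y =>
      have hl : x.length = y.length := by simpa using hl
      rw [expand, expand, hl] at h
      have := List.append_cancel_left h
      rw [List.cons.injEq] at this
      rw [this.1, ih this.2]

lemma expand_suffix_iff {x y : List Bool} : expand L x <:+ expand L y ↔ x <:+ y := by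
  refine ⟨fun h => ?_, expand_suffix_expand⟩
  have hl : x.length ≤ y.length := by
    by_contra! h'
    have := length_expand_lt (L := L) h'
    have := h.length_le
    omega
  have h2 : y.drop (y.length - x.length) <:+ y := List.drop_suffix _ _
  have h3 : (y.drop (y.length - x.length)).length = x.length := by simp; omega
  have h4 := List.suffix_of_suffix_length_le h (expand_suffix_expand (L := L) h2)
    (length_expand_eq h3.symm).le
  rw [expand_injective (h4.eq_of_length (length_expand_eq h3.symm))]
  exact h2

/-- Every edge of the subdivided tree lies on the path of some edge of the binary tree. -/
lemma exists_segment_of_cons_suffix {c : Bool} {s u : List Bool} (h : c :: s <:+ expand L u) :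
    ∃ b t, b :: t <:+ u ∧ expand L t <:+ s ∧ c :: s <:+ expand L (b :: t) := by
  induction u with
  | nil => simp [expand] at h
  | cons b u ih =>
    rcases List.suffix_or_suffix_of_suffix h (expand_suffix_expand_cons b u) with h' | h'
    · obtain ⟨b', t, h1, h2⟩ := ih h'
      exact ⟨b', t, h1.trans (List.suffix_cons _ _), h2⟩
    · rcases List.suffix_cons_iff.1 h' with h' | h'
      · obtain ⟨b', t, h1, h2⟩ := ih (h' ▸ List.suffix_rfl)
        exact ⟨b', t, h1.trans (List.suffix_cons _ _), h2⟩
      · exact ⟨b, u, List.suffix_rfl, h', h⟩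

lemma segment_start_unique {s t t' : List Bool} {b b' : Bool}
    (h1 : expand L t <:+ s) (h2 : s.length < (expand L (b :: t)).length)
    (h1' : expand L t' <:+ s) (h2' : s.length < (expand L (b' :: t')).length) : t = t' := by
  have a1 := length_expand_lt_iff.1 (h1.length_le.trans_lt h2')
  have a2 := length_expand_lt_iff.1 (h1'.length_le.trans_lt h2)
  simp only [List.length_cons] at a1 a2
  have a3 : (expand L t).length = (expand L t').length := length_expand_eq (by omega)
  exact expand_injective ((List.suffix_of_suffix_length_le h1 h1' a3.le).eq_of_length a3)

lemma segment_direction_unique {s t : List Bool} {b b' : Bool}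
    (h1 : expand L t <:+ s) (h2 : expand L t ≠ s) (h3 : s <:+ expand L (b :: t))
    (h3' : s <:+ expand L (b' :: t)) : b = b' := by
  have hl : (expand L t).length < s.length :=
    lt_of_le_of_ne h1.length_le fun h => h2 (h1.eq_of_length h)
  have k1 := List.suffix_of_suffix_length_le (cons_expand_suffix b t) h3 (by simpa using hl)
  have k2 := List.suffix_of_suffix_length_le (cons_expand_suffix b' t) h3' (by simpa using hl)
  have k3 := (List.suffix_of_suffix_length_le k1 k2 (by simp)).eq_of_length (by simp)
  simpa using k3

/-- The interior vertices of the paths of a subdivision are not branching. -/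
lemma cons_suffix_of_interior {c b : Bool} {s t u : List Bool} (h1 : expand L t <:+ s)
    (h2 : expand L t ≠ s) (h3 : s <:+ expand L (b :: t)) (h4 : s ≠ expand L (b :: t))
    (h : c :: s <:+ expand L u) : c :: s <:+ expand L (b :: t) := by
  obtain ⟨b', t', -, k1, k2⟩ := exists_segment_of_cons_suffix h
  have e : t = t' := segment_start_unique h1
    (lt_of_le_of_ne h3.length_le fun h => h4 (h3.eq_of_length h)) k1
    (lt_of_lt_of_le (by simp) k2.length_le)
  subst e
  rwa [segment_direction_unique h1 h2 h3 ((List.suffix_cons _ _).trans k2)]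

/-! ### The length of the longest common suffix -/

/-- The length of the longest common suffix of two words: the depth of the last common ancestor. -/
def meetDepth : List Bool → List Bool → ℕ
  | [], _ => 0
  | b :: w, v => if b :: w <:+ v then w.length + 1 else meetDepth w v

lemma meetDepth_le (w v : List Bool) : meetDepth w v ≤ w.length := by
  induction w with
  | nil => rfl
  | cons b w ih => unfold meetDepth; split_ifs <;> simp; omega

lemma suffix_iff_le_meetDepth {w x : List Bool} (v : List Bool) (h : x <:+ w) :
    x <:+ v ↔ x.length ≤ meetDepth w v := by
  induction w with
  | nil => rw [List.suffix_nil] at h; subst h; simp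
  | cons b w ih =>
    unfold meetDepth
    split_ifs with h'
    · exact ⟨fun _ => by simpa using h.length_le, fun _ => h.trans h'⟩
    · rcases List.suffix_cons_iff.1 h with rfl | h
      · have := meetDepth_le w v
        simp only [h', List.length_cons, false_iff]; omega
      · exact ih h

lemma suffix_iff_meetDepth_eq {w v : List Bool} : w <:+ v ↔ meetDepth w v = w.length := by
  rw [suffix_iff_le_meetDepth v List.suffix_rfl]
  have := meetDepth_le w v
  omega

lemma meetDepth_le_right (w v : List Bool) : meetDepth w v ≤ v.length := by
  have h2 := (suffix_iff_le_meetDepth v (List.drop_suffix (w.length - meetDepth w v) w)).2 (by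
    simp; omega)
  have := h2.length_le
  have := meetDepth_le w v
  simp at *
  omega

/-- The depth of the last common ancestor with `w` changes by at most one along an edge; so it bounds
from below the time that a robber needs. -/
lemma meetDepth_cons (w v : List Bool) (b : Bool) :
    meetDepth w v ≤ meetDepth w (b :: v) ∧ meetDepth w (b :: v) ≤ meetDepth w v + 1 := by
  have key : ∀ v, w.drop (w.length - meetDepth w v) <:+ v := fun v =>
    (suffix_iff_le_meetDepth v (List.drop_suffix _ w)).2 (by simp; omega)
  have hl : ∀ v, (w.drop (w.length - meetDepth w v)).length = meetDepth w v := fun v => by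
    have := meetDepth_le w v
    simp; omega
  constructor
  · have := (suffix_iff_le_meetDepth (b :: v) (List.drop_suffix _ w)).1
      ((key v).trans (List.suffix_cons _ _))
    rwa [hl] at this
  · by_contra! h
    have h1 := List.suffix_of_suffix_length_le (List.drop_suffix 1 _ |>.trans (key (b :: v)))
      (List.suffix_cons b v) (by
        have := (key (b :: v)).length_le
        simp only [List.length_drop, List.length_cons] at *
        omega)
    rw [suffix_iff_le_meetDepth v ((List.drop_suffix _ _).trans (List.drop_suffix _ _))] at h1
    have := hl (b :: v)
    rw [List.length_drop, this] at h1
    omega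

/-! ### Subdivided binary trees -/

/-- The vertices of the subdivided binary tree of height `h`: all ancestors of its nodes. -/
abbrev TreeVertex (L : ℕ → ℕ) (h : ℕ) : Type :=
  {x : List Bool // ∃ u : List Bool, u.length ≤ h ∧ x <:+ expand L u}

/-- The complete binary tree of height `h` in which every edge below a node of depth `k` is replaced
by a path of length `L k + 1`. -/
def subdividedTree (L : ℕ → ℕ) (h : ℕ) : SimpleGraph (TreeVertex L h) where
  Adj x y := (∃ b, y.1 = b :: x.1) ∨ (∃ b, x.1 = b :: y.1)
  symm := ⟨fun _ _ hxy => hxy.symm⟩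
  loopless := ⟨fun x hx => by
    rcases hx with ⟨b, hb⟩ | ⟨b, hb⟩ <;> simpa using congrArg List.length hb⟩

instance finite_treeVertex : Finite (TreeVertex L h) := by
  have h1 : {u : List Bool | u.length ≤ h}.Finite := List.finite_length_le Bool h
  have h2 : (⋃ u ∈ {u : List Bool | u.length ≤ h}, {x | x <:+ expand L u}).Finite :=
    h1.biUnion fun u _ => (List.finite_toSet (expand L u).tails).subset fun x hx => by
      simpa using hx
  refine (h2.subset ?_).to_subtype
  rintro x ⟨u, hu, hx⟩
  simpa using ⟨u, hu, hx⟩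

instance nonempty_treeVertex : Nonempty (TreeVertex L h) := ⟨⟨[], [], by simp⟩⟩

/-- The vertex of the subdivided tree that represents a node of the binary tree. -/
def node (L : ℕ → ℕ) (u : List Bool) (hu : u.length ≤ h) : TreeVertex L h :=
  ⟨expand L u, u, hu, List.suffix_rfl⟩

/-- The walk from a vertex up to one of its ancestors. -/
lemma exists_walk_to_ancestor (v t : TreeVertex L h) (hs : t.1 <:+ v.1) :
    ∃ p : (subdividedTree L h).Walk v t, p.IsPath ∧
      (∀ x, x ∈ p.support ↔ t.1 <:+ x.1 ∧ x.1 <:+ v.1) ∧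
      (∀ x y : TreeVertex L h, ∀ c, t.1 <:+ x.1 → y.1 = c :: x.1 → y.1 <:+ v.1 →
        s(x, y) ∈ p.edges) := by
  obtain ⟨l, hl⟩ := v
  induction l with
  | nil =>
    obtain rfl : t = ⟨[], hl⟩ := Subtype.ext (List.suffix_nil.1 hs)
    refine ⟨.nil, .nil, fun x => ?_, fun x y c _ hy hy' => ?_⟩
    · simp [Subtype.ext_iff]
    · rw [hy] at hy'; simp at hy'
  | cons b l ih =>
    rcases List.suffix_cons_iff.1 hs with e | hs'
    · obtain rfl : t = ⟨b :: l, hl⟩ := Subtype.ext e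
      refine ⟨.nil, .nil, fun x => ?_, fun x y c h1 hy hy' => ?_⟩
      · simp only [SimpleGraph.Walk.support_nil, List.mem_singleton, Subtype.ext_iff]
        exact ⟨fun e => by simp [e], fun e => e.2.eq_of_length_le e.1.length_le⟩
      · have h1 := h1.length_le
        have h2 := hy'.length_le
        rw [hy] at h2
        simp at h1 h2
        omega
    · have hl' : ∃ u : List Bool, u.length ≤ h ∧ l <:+ expand L u :=
        hl.imp fun u hu => ⟨hu.1, (List.suffix_cons b l).trans hu.2⟩
      obtain ⟨p, hp, hsup, hedge⟩ := ih hl' hs'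
      have hadj : (subdividedTree L h).Adj ⟨b :: l, hl⟩ ⟨l, hl'⟩ := Or.inr ⟨b, rfl⟩
      refine ⟨.cons hadj p, ?_, fun x => ?_, fun x y c h1 hy hy' => ?_⟩
      · refine hp.cons fun hmem => ?_
        have := ((hsup _).1 hmem).2.length_le
        simp at this
      · rw [SimpleGraph.Walk.support_cons, List.mem_cons, hsup, Subtype.ext_iff,
          List.suffix_cons_iff]
        constructor
        · rintro (e | e)
          · exact ⟨e ▸ hs, Or.inl e⟩
          · exact ⟨e.1, Or.inr e.2⟩
        · rintro ⟨e1, e | e⟩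
          · exact Or.inl e
          · exact Or.inr ⟨e1, e⟩
      · rw [SimpleGraph.Walk.edges_cons, List.mem_cons]
        rcases List.suffix_cons_iff.1 hy' with e | e
        · left
          rw [hy] at e
          have e1 : x = ⟨l, hl'⟩ := Subtype.ext (List.cons.inj e).2
          have e2 : y = ⟨b :: l, hl⟩ := Subtype.ext (hy.trans e)
          rw [e1, e2, Sym2.eq_swap]
        · exact Or.inr (hedge x y c h1 hy e)

theorem isTree_subdividedTree : (subdividedTree L h).IsTree := by
  refine ⟨{ preconnected := fun x y => ?_ }, ?_⟩
  · obtain ⟨p, -⟩ := exists_walk_to_ancestor x ⟨[], [], by simp⟩ List.nil_suffix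
    obtain ⟨q, -⟩ := exists_walk_to_ancestor y ⟨[], [], by simp⟩ List.nil_suffix
    exact ⟨p.append q.reverse⟩
  · rw [SimpleGraph.isAcyclic_iff_forall_adj_isBridge]
    -- the edge above `y` is a bridge: without it, no edge leaves the set of descendants of `y`
    have key : ∀ x y : TreeVertex L h, ∀ b, y.1 = b :: x.1 →
        ¬ ((subdividedTree L h).deleteEdges {s(x, y)}).Reachable y x := by
      rintro x y b hb ⟨p⟩
      have : ∀ z w : TreeVertex L h, ((subdividedTree L h).deleteEdges {s(x, y)}).Walk z w →
          y.1 <:+ z.1 → y.1 <:+ w.1 := by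
        intro z w q
        induction q with
        | nil => exact id
        | cons hadj _ ih =>
          intro hz
          refine ih ?_
          rw [SimpleGraph.deleteEdges_adj] at hadj
          rcases hadj with ⟨⟨c, hc⟩ | ⟨c, hc⟩, hne⟩
          · exact hc ▸ hz.trans (List.suffix_cons _ _)
          · rw [hc] at hz
            rcases List.suffix_cons_iff.1 hz with e | e
            · refine absurd ?_ hne
              rw [← hc] at e
              rw [hb, hc, List.cons.injEq] at e
              rw [Set.mem_singleton_iff, Sym2.eq_iff]
              exact Or.inr ⟨Subtype.ext (by rw [hc, hb, e.1, e.2]), Subtype.ext e.2.symm⟩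
            · exact e
      have := (this y x p List.suffix_rfl).length_le
      rw [hb] at this
      simp at this
    intro x y hxy
    rw [SimpleGraph.isBridge_iff]
    rcases hxy with ⟨b, hb⟩ | ⟨b, hb⟩
    · exact fun hr => key x y b hb hr.symm
    · rw [Sym2.eq_swap]
      exact fun hr => key y x b hb hr

theorem isSubcubic_subdividedTree : IsSubcubic (subdividedTree L h) := by
  intro v
  have hsub : Subtype.val '' ((subdividedTree L h).neighborSet v) ⊆
      {v.1.tail, false :: v.1, true :: v.1} := by
    rintro _ ⟨x, ⟨b, hb⟩ | ⟨b, hb⟩, rfl⟩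
    · cases b <;> simp [hb]
    · simp [hb]
  rw [← Subtype.val_injective.encard_image]
  refine (Set.encard_le_encard hsub).trans ?_
  refine (Set.encard_insert_le _ _).trans ?_
  refine (add_le_add_left (Set.encard_insert_le _ _) _).trans ?_
  rw [Set.encard_singleton]
  norm_num

theorem isSubdivision_subdividedTree :
    IsSubdivision (subdividedTree L h) (completeBinaryTree h) := by
  have hT : (subdividedTree L h).IsTree := isTree_subdividedTree
  let f : {w : List Bool // w.length ≤ h} → TreeVertex L h := fun u => node L u.1 u.2
  choose P hP using fun u v => (hT.existsUnique_path (f u) (f v)).exists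
  have huniq : ∀ {x y} {p q : (subdividedTree L h).Walk x y}, p.IsPath → q.IsPath → p = q :=
    fun hp hq => (hT.existsUnique_path _ _).unique hp hq
  have hrev : ∀ u v, P v u = (P u v).reverse := fun u v => huniq (hP _ _) (hP _ _).reverse
  -- the path of an edge consists of the vertices between its ends
  have hup : ∀ (u v : {w : List Bool // w.length ≤ h}) b, v.1 = b :: u.1 →
      (∀ x, x ∈ (P v u).support ↔ expand L u.1 <:+ x.1 ∧ x.1 <:+ expand L v.1) ∧
      (∀ x y : TreeVertex L h, ∀ c, expand L u.1 <:+ x.1 → y.1 = c :: x.1 →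
        y.1 <:+ expand L v.1 → s(x, y) ∈ (P v u).edges) := by
    intro u v b hb
    obtain ⟨p, hp, h1, h2⟩ := exists_walk_to_ancestor (f v) (f u)
      (by
        rw [show (f v).1 = expand L v.1 from rfl, hb]; exact expand_suffix_expand_cons b u.1)
    rw [huniq (hP v u) hp]
    exact ⟨h1, h2⟩
  have hsup : ∀ u v, (completeBinaryTree h).Adj u v → ∃ b t, (b :: t).length ≤ h ∧
      s(u.1, v.1) = s(t, b :: t) ∧
      ∀ x, x ∈ (P u v).support ↔ expand L t <:+ x.1 ∧ x.1 <:+ expand L (b :: t) := by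
    rintro u v (⟨b, hb⟩ | ⟨b, hb⟩)
    · refine ⟨b, u.1, hb ▸ v.2, by rw [hb], fun x => ?_⟩
      rw [hrev v u, SimpleGraph.Walk.support_reverse, List.mem_reverse, (hup u v b hb).1, hb]
    · refine ⟨b, v.1, hb ▸ u.2, by rw [hb, Sym2.eq_swap], fun x => ?_⟩
      rw [(hup v u b hb).1, hb]
  refine ⟨f, fun u v _ => P u v, ?_, fun u v _ => hP u v, fun u v _ => hrev u v, ?_, ?_, ?_, ?_⟩
  · intro u v huv
    exact Subtype.ext (expand_injective (congrArg Subtype.val huv))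
  · intro u v huv w hw
    obtain ⟨b, t, -, he, hs⟩ := hsup u v huv
    obtain ⟨h1, h2⟩ := (hs _).1 hw
    rw [show (f w).1 = expand L w.1 from rfl, expand_suffix_iff] at h1 h2
    have hw' : w.1 = t ∨ w.1 = b :: t := by
      rcases List.suffix_cons_iff.1 h2 with e | e
      · exact Or.inr e
      · exact Or.inl (e.eq_of_length_le h1.length_le)
    have hmem : w.1 ∈ s(u.1, v.1) := by rw [he]; simpa using hw'
    simpa [Subtype.ext_iff] using hmem
  · intro u v huv u' v' huv' x hne hx hx'
    obtain ⟨b, t, ht, he, hs⟩ := hsup u v huv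
    obtain ⟨b', t', ht', he', hs'⟩ := hsup u' v' huv'
    obtain ⟨h1, h2⟩ := (hs _).1 hx
    obtain ⟨h1', h2'⟩ := (hs' _).1 hx'
    by_contra hr
    have hr' : ∀ w : List Bool, w.length ≤ h → x.1 ≠ expand L w :=
      fun w hw e => hr ⟨⟨w, hw⟩, Subtype.ext e.symm⟩
    have ett : t = t' := segment_start_unique h1
      (lt_of_le_of_ne h2.length_le fun e => hr' _ ht (h2.eq_of_length e)) h1'
      (lt_of_le_of_ne h2'.length_le fun e => hr' _ ht' (h2'.eq_of_length e))
    subst ett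
    have ebb : b = b' := segment_direction_unique h1
      (fun e => hr' t (by simp at ht; omega) e.symm) h2 h2'
    subst ebb
    refine hne ?_
    have := he.trans he'.symm
    simpa [Subtype.ext_iff] using this
  · intro x
    obtain ⟨u, hu, hx⟩ := x.2
    rcases hxl : x.1 with _ | ⟨c, s⟩
    · exact Or.inl ⟨⟨[], by simp⟩, Subtype.ext (by rw [hxl]; rfl)⟩
    · right
      rw [hxl] at hx
      obtain ⟨b, t, h1, h2, h3⟩ := exists_segment_of_cons_suffix hx
      have hbt := h1.length_le.trans hu
      refine ⟨⟨b :: t, hbt⟩, ⟨t, by simp at hbt; omega⟩, Or.inr ⟨b, rfl⟩, ?_⟩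
      exact ((hup ⟨t, by simp at hbt; omega⟩ ⟨b :: t, hbt⟩ b rfl).1 x).2
        ⟨by rw [hxl]; exact h2.trans (List.suffix_cons _ _), by rw [hxl]; exact h3⟩
  · have main : ∀ x y : TreeVertex L h, ∀ c, y.1 = c :: x.1 → ∃ u v, ∃ _ :
        (completeBinaryTree h).Adj u v, s(x, y) ∈ (P u v).edges := by
      intro x y c hc
      obtain ⟨u, hu, hy⟩ := y.2
      rw [hc] at hy
      obtain ⟨b, t, h1, h2, h3⟩ := exists_segment_of_cons_suffix hy
      have hbt := h1.length_le.trans hu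
      refine ⟨⟨b :: t, hbt⟩, ⟨t, by simp at hbt; omega⟩, Or.inr ⟨b, rfl⟩, ?_⟩
      exact (hup ⟨t, by simp at hbt; omega⟩ ⟨b :: t, hbt⟩ b rfl).2 x y c h2 hc (hc ▸ h3)
    intro e
    induction e using Sym2.ind with
    | h x y =>
      rintro (⟨c, hc⟩ | ⟨c, hc⟩)
      · obtain ⟨u, v, huv, hmem⟩ := main x y c hc
        exact ⟨u, v, huv, hmem⟩
      · obtain ⟨u, v, huv, hmem⟩ := main y x c hc
        exact ⟨u, v, huv, by rwa [Sym2.eq_swap]⟩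

end Trees

/-! ### Plays of the blind cops and robber game -/

section Play

variable {V : Type*} {G : SimpleGraph V} {r k : ℕ} {X Y K : Set V}

/-- `Play G r k X n C A C' A'`: in `n` rounds, `k` cops can move from `C` to `C'` without ever
leaving a vertex of `X`, and an unseen robber of speed `r` who could be anywhere in `A` before these
rounds can be anywhere in `A'` after them. -/
inductive Play (G : SimpleGraph V) (r k : ℕ) (X : Set V) :
    ℕ → Finset V → Set V → Finset V → Set V → Prop
  /-- no round is played -/
  | refl (C : Finset V) (A : Set V) (hX : X ⊆ C) : Play G r k X 0 C A C A
  /-- one more round, in which the cops move from `C'` to `C''` -/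
  | step {n : ℕ} {C C' : Finset V} {A A' : Set V} (C'' : Finset V) (hX : X ⊆ C'')
      (hk : C''.card ≤ k) :
      Play G r k X n C A C' A' →
      Play G r k X (n + 1) C A C'' ({u | u ∉ C''} ∩ spread G r {x | x ∈ C' ∧ x ∈ C''} A')

lemma Play.mono (hYX : Y ⊆ X) {n : ℕ} {C C' : Finset V} {A A' : Set V}
    (h : Play G r k X n C A C' A') : Play G r k Y n C A C' A' := by
  induction h with
  | refl C A hX => exact .refl C A (hYX.trans hX)
  | step C'' hX hk _ ih => exact .step C'' (hYX.trans hX) hk ih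

lemma Play.trans {m n : ℕ} {C C' C'' : Finset V} {A A' A'' : Set V}
    (h : Play G r k X m C A C' A') (h' : Play G r k X n C' A' C'' A'') :
    Play G r k X (m + n) C A C'' A'' := by
  induction h' with
  | refl => exact h
  | step D hX hk _ ih => exact .step D hX hk (ih h)

lemma exists_play_move {C C' : Finset V} (A : Set V) (hX : X ⊆ C) (hX' : X ⊆ C')
    (hk : C'.card ≤ k) : ∃ A', Play G r k X 1 C A C' A' ∧ ∀ v ∈ A', v ∉ C' :=
  ⟨_, .step C' hX' hk (.refl C A hX), fun _ hv => hv.1⟩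

lemma Play.subset_right {n : ℕ} {C C' : Finset V} {A A' : Set V} (h : Play G r k X n C A C' A') :
    X ⊆ C' := by
  cases h with
  | refl C A hX => exact hX
  | step _ hX _ _ => exact hX

/-- `X` guards `K` if every edge between `K` and its complement has an end in `X`. -/
def Guards (G : SimpleGraph V) (X K : Set V) : Prop :=
  ∀ u v, G.Adj u v → u ∈ K → v ∉ K → u ∈ X ∨ v ∈ X

lemma Guards.compl (h : Guards G X K) : Guards G X Kᶜ := fun u v huv hu hv =>
  (h v u huv.symm (not_not.1 hv) hu).symm

lemma Guards.mono (h : Guards G X K)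
    (hXY : X ⊆ Y) : Guards G Y K :=
  fun u v huv hu hv => (h u v huv hu hv).imp (@hXY u) (@hXY v)

lemma guards_univ : Guards G X Set.univ := fun _ _ _ _ hv => absurd (Set.mem_univ _) hv

lemma Guards.mem_of_walk (h : Guards G X K) {a u : V} (p : G.Walk a u)
    (hp : ∀ x ∈ p.support, x ∉ X) (hu : u ∈ K) : a ∈ K := by
  induction p with
  | nil => exact hu
  | cons hadj p ih =>
    rw [SimpleGraph.Walk.support_cons] at hp
    have hb := ih (fun x hx => hp x (List.mem_cons_of_mem _ hx)) hu
    by_contra ha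
    rcases h _ _ hadj.symm hb ha with h' | h'
    · exact hp _ (List.mem_cons_of_mem _ p.start_mem_support) h'
    · exact hp _ List.mem_cons_self h'

/-- While the cops on `X` stay put, the robber enters `K` neither from outside, if `X` guards `K`,
nor faster than his speed allows. -/
lemma Play.exists_walk (hG : Guards G X K) {n : ℕ} {C C' : Finset V} {A A' : Set V}
    (h : Play G r k X n C A C' A') {v : V} (hv : v ∈ A') (hvK : v ∈ K) :
    ∃ a ∈ A, a ∈ K ∧ ∃ p : G.Walk a v, p.length ≤ r * n := by
  induction h generalizing v with
  | refl C A hX => exact ⟨v, hv, hvK, .nil, by simp⟩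
  | step C'' hX hk h' ih =>
    obtain ⟨-, b, hb, p, -, hpl, hps⟩ := hv
    have hX' := h'.subset_right
    have hbK : b ∈ K := hG.mem_of_walk p (fun x hx hxX => hps x hx ⟨hX' hxX, hX hxX⟩) hvK
    obtain ⟨a, ha, haK, q, hq⟩ := ih hb hbK
    refine ⟨a, ha, haK, q.append p, ?_⟩
    rw [SimpleGraph.Walk.length_append, Nat.mul_succ]
    omega

/-- A guarded region without the robber stays so. -/
lemma Play.disjoint_of_guards (hG : Guards G X K) {n : ℕ} {C C' : Finset V} {A A' : Set V}
    (h : Play G r k X n C A C' A') (hA : ∀ v ∈ A, v ∉ K) : ∀ v ∈ A', v ∉ K := by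
  intro v hv hvK
  obtain ⟨a, ha, haK, -⟩ := h.exists_walk hG hv hvK
  exact hA a ha haK

lemma copTerritory_congr {C D : ℕ → Finset V} {m : ℕ} (h : ∀ i ≤ m, C i = D i) :
    copTerritory G r C m = copTerritory G r D m := by
  induction m with
  | zero => simp [copTerritory, h 0 le_rfl]
  | succ m ih =>
    simp only [copTerritory]
    rw [ih fun i hi => h i (by omega), h m (by omega), h (m + 1) le_rfl]

/-- A play from the start of the game is given by a sequence of positions of the cops. -/
lemma Play.exists_strategy {n : ℕ} {C C' : Finset V} {A A' : Set V}
    (h : Play G r k X n C A C' A') (hA : A = {u | u ∉ C}) (hC : C.card ≤ k) :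
    ∃ D : ℕ → Finset V, (∀ i, (D i).card ≤ k) ∧ D n = C' ∧ copTerritory G r D n = A' := by
  induction h with
  | refl C A hX => exact ⟨fun _ => C, fun _ => hC, rfl, hA.symm⟩
  | @step n _ _ _ _ C'' hX hk h' ih =>
    obtain ⟨D, h1, h2, h3⟩ := ih hA hC
    refine ⟨fun i => if i ≤ n then D i else C'', fun i => ?_, by simp, ?_⟩
    · dsimp only
      split_ifs
      exacts [h1 i, hk]
    · simp only [copTerritory]
      rw [copTerritory_congr (D := D) fun i hi => by simp [hi], h3]
      simp [h2]

end Play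

/-! ### From cops to flips -/

section Flips

variable {V : Type*}

open Classical in
/-- The flip that isolates the vertices of `C`: its parts are the vertices of `C` and the sets of
all other vertices with the same neighbours in `C`. -/
lemma exists_flip_isolating (G : SimpleGraph V) (C : Finset V) {k : ℕ} (hC : C.card ≤ k) :
    ∃ φ : FlipData V (k + 2 ^ k), (∀ c ∈ C, (flip G φ).IsIsolated c) ∧
      ∀ u v, (flip G φ).Adj u v → G.Adj u v := by
  let T := {x // x ∈ C} ⊕ Set {x // x ∈ C}
  have hT : Fintype.card T ≤ k + 2 ^ k := by
    simp only [T, Fintype.card_sum, Fintype.card_coe, Fintype.card_set]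
    exact Nat.add_le_add hC (Nat.pow_le_pow_right (by norm_num) hC)
  let e : T ↪ Fin (k + 2 ^ k) := (Fintype.equivFin T).toEmbedding.trans (Fin.castLEEmb hT)
  let part : V → T := fun v => if hv : v ∈ C then .inl ⟨v, hv⟩ else .inr {c | G.Adj c v}
  -- two parts are flipped if one of them is a vertex of `C` that is adjacent to the other part
  let R : T → T → Prop := fun s t => ∃ u v, part u = s ∧ part v = t ∧ G.Adj u v ∧ (u ∈ C ∨ v ∈ C)
  have hR : ∀ u v, R (part u) (part v) ↔ G.Adj u v ∧ (u ∈ C ∨ v ∈ C) := by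
    have key : ∀ c v u' v', c ∈ C → part u' = part c → part v' = part v → G.Adj u' v' →
        G.Adj c v := by
      intro c v u' v' hc hu hv hadj
      have hu' : u' = c := by
        by_cases h : u' ∈ C
        · simp only [part, h, hc, dite_true] at hu
          exact congrArg Subtype.val (Sum.inl.inj hu)
        · simp [part, h, hc] at hu
      subst hu'
      by_cases hvC : v ∈ C <;> by_cases hvC' : v' ∈ C
      · simp only [part, hvC, hvC', dite_true] at hv
        rwa [show v' = v from congrArg Subtype.val (Sum.inl.inj hv)] at hadj
      · simp [part, hvC, hvC'] at hv
      · simp [part, hvC, hvC'] at hv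
      · simp only [part, hvC, hvC', dite_false] at hv
        have hv := Sum.inr.inj hv
        have : (⟨u', hc⟩ : {x // x ∈ C}) ∈ {c : {x // x ∈ C} | G.Adj c v'} := hadj
        rw [hv] at this
        exact this
    have memC : ∀ u u', part u' = part u → u' ∈ C → u ∈ C := by
      intro u u' h hu'
      by_contra hu
      simp [part, hu, hu'] at h
    refine fun u v => ⟨?_, fun h => ⟨u, v, rfl, rfl, h.1, h.2⟩⟩
    rintro ⟨u', v', hu, hv, hadj, hC' | hC'⟩
    · have := memC u u' hu hC'
      exact ⟨key u v u' v' this hu hv hadj, Or.inl this⟩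
    · have := memC v v' hv hC'
      exact ⟨(key v u v' u' this hv hu hadj.symm).symm, Or.inr this⟩
  let φ : FlipData V (k + 2 ^ k) :=
    { part := fun v => e (part v)
      F := fun i j => ∃ s t, e s = i ∧ e t = j ∧ R s t
      symm := by
        rintro i j ⟨s, t, hs, ht, u, v, hu, hv, hadj, h⟩
        exact ⟨t, s, ht, hs, v, u, hv, hu, hadj.symm, h.symm⟩ }
  have hF : ∀ u v, φ.F (φ.part u) (φ.part v) ↔ G.Adj u v ∧ (u ∈ C ∨ v ∈ C) := by
    intro u v
    rw [← hR]
    constructor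
    · rintro ⟨s, t, hs, ht, h⟩
      rwa [e.injective hs, e.injective ht] at h
    · exact fun h => ⟨_, _, rfl, rfl, h⟩
  have hadj : ∀ u v, (flip G φ).Adj u v ↔ G.Adj u v ∧ u ∉ C ∧ v ∉ C := by
    intro u v
    have := G.ne_of_adj (a := u) (b := v)
    simp only [flip, hF]
    tauto
  refine ⟨φ, fun c hc w h => ((hadj c w).1 h).2.1 hc, fun u v h => ((hadj u v).1 h).1⟩

/-- If `k` cops win the blind cops and robber game, then the flipper wins the blind flipper game with
`k + 2 ^ k` parts, by isolating the vertices that the cops occupy. -/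
theorem exists_flip_strategy {G : SimpleGraph V} {r k : ℕ} {C : ℕ → Finset V}
    (hC : ∀ i, (C i).card ≤ k) {m : ℕ} (hm : copTerritory G r C m = ∅) :
    ∃ φ : ℕ → FlipData V (k + 2 ^ k), ∃ m, flipTerritory G r φ m = ∅ := by
  choose φ hiso hsub using fun i => exists_flip_isolating G (C i) (hC i)
  have not_mem : ∀ i v, ¬ (flipGraph G φ (i + 1)).IsIsolated v → v ∉ C i :=
    fun i v hv hvC => hv (hiso i v hvC)
  have key : ∀ i, flipTerritory G r φ (i + 1) ⊆ copTerritory G r C i := by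
    intro i
    induction i with
    | zero => exact fun v hv => not_mem 0 v hv.1
    | succ i ih =>
      rintro v ⟨hv, a, ha, p, hp, hpl, -⟩
      have hle : flipGraph G φ (i + 1) ≤ G := fun _ _ h => hsub i _ _ h
      refine ⟨not_mem _ v hv, a, ih ha, p.mapLe hle, hp.mapLe hle, ?_, ?_⟩
      · exact (SimpleGraph.Walk.length_map _ p).le.trans hpl
      · -- isolated vertices are not on the path, unless the robber starts there
        have avoid : ∀ {x y : V} (q : (flipGraph G φ (i + 1)).Walk x y), x ∉ C i →
            ∀ z ∈ q.support, z ∉ C i := by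
          intro x y q
          induction q with
          | nil => intro hx z hz; simp at hz; exact hz ▸ hx
          | cons hadj q ih =>
            intro hx z hz
            rw [SimpleGraph.Walk.support_cons, List.mem_cons] at hz
            rcases hz with rfl | hz
            · exact hx
            · exact ih (fun h => hiso i _ h _ hadj.symm) z hz
        intro x hx hxC
        refine avoid p (not_mem i a ha.1) x ?_ hxC.1
        simpa [SimpleGraph.Walk.mapLe] using hx
  exact ⟨φ, m + 1, Set.subset_empty_iff.1 (hm ▸ key m)⟩

end Flips

/-! ### Clearing a subdivided binary tree with four cops -/

section CopStrategy

variable {L : ℕ → ℕ} {h r : ℕ}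

lemma meetDepth_le_of_walk (w : List Bool) {a v : TreeVertex L h}
    (p : (subdividedTree L h).Walk a v) :
    meetDepth w a.1 ≤ meetDepth w v.1 + p.length ∧
      meetDepth w v.1 ≤ meetDepth w a.1 + p.length := by
  induction p with
  | nil => simp
  | cons hadj p ih =>
    rw [SimpleGraph.Walk.length_cons]
    rcases hadj with ⟨b, hb⟩ | ⟨b, hb⟩
    · have := hb ▸ meetDepth_cons w _ b
      omega
    · have := hb ▸ meetDepth_cons w _ b
      omega

/-- The ancestors of `w` of depth more than `c` and less than that of `w` are not branching: every
vertex that leaves the branch of `w` between these depths is itself an ancestor of `w`. -/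
def UnbranchedAbove (c : ℤ) (w : TreeVertex L h) : Prop :=
  ∀ v : TreeVertex L h, c < meetDepth w.1 v.1 → meetDepth w.1 v.1 < w.1.length → v.1 <:+ w.1

lemma unbranchedAbove_node {b : Bool} {u : List Bool} (hu : (b :: u).length ≤ h) :
    UnbranchedAbove (expand L u).length (node L (b :: u) hu) := by
  intro v h1 h2
  change meetDepth (expand L (b :: u)) v.1 < (expand L (b :: u)).length at h2
  change ((expand L u).length : ℤ) < meetDepth (expand L (b :: u)) v.1 at h1
  change v.1 <:+ expand L (b :: u)
  have hm : ∃ m, m <:+ expand L (b :: u) ∧ m.length = meetDepth (expand L (b :: u)) v.1 :=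
    ⟨_, List.drop_suffix ((expand L (b :: u)).length - meetDepth (expand L (b :: u)) v.1) _, by
      rw [List.length_drop]; omega⟩
  obtain ⟨m, hm, hml⟩ := hm
  have hmv : m <:+ v.1 := (suffix_iff_le_meetDepth v.1 hm).2 hml.le
  obtain ⟨t, ht⟩ := hmv
  rcases List.eq_nil_or_concat t with rfl | ⟨t', d, rfl⟩
  · rw [← ht]; exact hm
  · have hd : d :: m <:+ v.1 := ⟨t', by rw [← ht]; simp⟩
    obtain ⟨u', -, hu'⟩ := v.2
    have hum : expand L u <:+ m :=
      List.suffix_of_suffix_length_le (expand_suffix_expand_cons b u) hm (by omega)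
    have := cons_suffix_of_interior hum (fun e => by have := congrArg List.length e; omega) hm
      (fun e => by have := congrArg List.length e; omega) (hd.trans hu')
    have := (suffix_iff_le_meetDepth v.1 this).1 hd
    simp at this
    omega

lemma guards_descendants (x : TreeVertex L h) :
    Guards (subdividedTree L h) {x} {v | x.1 <:+ v.1} := by
  rintro u v (⟨b, hb⟩ | ⟨b, hb⟩) hu hv
  · have hu : x.1 <:+ u.1 := hu
    have := hu.trans (List.suffix_cons b u.1)
    rw [← hb] at this
    exact absurd this hv
  · have hu : x.1 <:+ u.1 := hu
    rw [hb] at hu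
    rcases List.suffix_cons_iff.1 hu with e | e
    · exact Or.inl (Subtype.ext (hb.trans e.symm))
    · exact absurd e hv

/-- A vertex separates the descendants of each of its children from the rest of the tree. -/
lemma guards_child (x : TreeVertex L h) (c : Bool) :
    Guards (subdividedTree L h) {x} {v | v = x ∨ c :: x.1 <:+ v.1} := by
  rintro u v (⟨b, hb⟩ | ⟨b, hb⟩) hu hv
  · rcases hu with rfl | hu
    · exact Or.inl rfl
    · exact absurd (Or.inr (hb ▸ hu.trans (List.suffix_cons b u.1))) hv
  · rcases hu with rfl | hu
    · exact Or.inl rfl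
    · rw [hb] at hu
      rcases List.suffix_cons_iff.1 hu with e | e
      · exact Or.inr (Subtype.ext (List.cons.inj e).2.symm)
      · exact absurd (Or.inr e) hv

lemma guards_segment {c : ℤ} {a b q : TreeVertex L h} (hb : UnbranchedAbove c b)
    (hc : c ≤ a.1.length) (hqb : q.1 <:+ b.1) :
    Guards (subdividedTree L h) {a, q} {v | a.1 <:+ v.1 ∧ v.1 <:+ q.1} := by
  rintro x y (⟨d, hd⟩ | ⟨d, hd⟩) ⟨hax, hxq⟩ hy
  · by_contra hne
    simp only [Set.mem_insert_iff, Set.mem_singleton_iff, not_or] at hne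
    have l1 : a.1.length < x.1.length := lt_of_le_of_ne hax.length_le fun e =>
      hne.1.1 (Subtype.ext (hax.eq_of_length e).symm)
    have l2 : x.1.length < q.1.length := lt_of_le_of_ne hxq.length_le fun e =>
      hne.1.2 (Subtype.ext (hxq.eq_of_length e))
    have l3 := hqb.length_le
    have hxy : x.1 <:+ y.1 := hd ▸ List.suffix_cons d x.1
    have hyl : y.1.length = x.1.length + 1 := by rw [hd]; rfl
    have l4 := (suffix_iff_le_meetDepth y.1 (hxq.trans hqb)).1 hxy
    have hyb : y.1 <:+ b.1 := by
      by_cases l5 : meetDepth b.1 y.1 < b.1.length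
      · exact hb y (by omega) l5
      · have := suffix_iff_meetDepth_eq.2 (le_antisymm (meetDepth_le b.1 y.1) (not_lt.1 l5))
        rw [this.eq_of_length_le (by omega)]
    exact hy ⟨hax.trans hxy, List.suffix_of_suffix_length_le hyb hqb (by omega)⟩
  · have hyx : y.1 <:+ x.1 := hd ▸ List.suffix_cons d y.1
    rw [hd] at hax
    rcases List.suffix_cons_iff.1 hax with e | e
    · exact Or.inl (Or.inl (Subtype.ext (hd.trans e.symm)))
    · exact absurd ⟨e, hyx.trans hxq⟩ hy

/-- Between two cops at the ends of an unbranched path, two further cops clear this path. -/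
lemma exists_play_sweep {c : ℤ} {a b : TreeVertex L h} (hb : UnbranchedAbove c b)
    (hc : c ≤ a.1.length) (hab : a.1 <:+ b.1) {A : Set (TreeVertex L h)} (haA : a ∉ A) :
    ∃ n A', n ≤ 2 * (b.1.length - a.1.length) ∧
      Play (subdividedTree L h) r 4 {a, b} n {a, b} A {a, b} A' ∧
      ∀ v ∈ A', ¬ (a.1 <:+ v.1 ∧ v.1 <:+ b.1) := by
  have key : ∀ (j : ℕ) (q : TreeVertex L h), q.1.length = a.1.length + j → a.1 <:+ q.1 →
      q.1 <:+ b.1 → ∃ A', Play (subdividedTree L h) r 4 {a, b} (2 * j) {a, b} A {a, b, q} A' ∧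
        ∀ v ∈ A', ¬ (a.1 <:+ v.1 ∧ v.1 <:+ q.1) := by
    intro j
    induction j with
    | zero =>
      intro q hq haq hqb
      obtain rfl : a = q := Subtype.ext (haq.eq_of_length hq.symm)
      refine ⟨A, ?_, fun v hv hav => haA ?_⟩
      · have e : ({a, b, a} : Finset (TreeVertex L h)) = {a, b} := by ext; simp; tauto
        rw [e]
        exact .refl _ _ (by simp)
      · rwa [show a = v from Subtype.ext (hav.1.eq_of_length_le hav.2.length_le)]
    | succ j ih =>
      intro q hq haq hqb
      rcases hq' : q.1 with _ | ⟨d, l⟩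
      · rw [hq'] at hq; simp at hq
      rw [hq'] at haq
      have hal : a.1 <:+ l := (List.suffix_cons_iff.1 haq).resolve_left fun e => by
        rw [hq', ← e] at hq; omega
      have hlq : l <:+ q.1 := hq' ▸ List.suffix_cons d l
      let p : TreeVertex L h := ⟨l, q.2.imp fun _ hu => ⟨hu.1, hlq.trans hu.2⟩⟩
      obtain ⟨A₀, hplay, hA₀⟩ := ih p (by
        rw [hq', List.length_cons] at hq
        exact Nat.succ.inj hq) hal
        (hlq.trans hqb)
      -- the front of the sweep advances while the cop at `p` stays, and then this cop leaves
      obtain ⟨A₁, step₁, hA₁⟩ := exists_play_move (G := subdividedTree L h) (r := r) (k := 4)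
        (X := {a, b, p}) (C := {a, b, p}) (C' := {a, b, p, q}) A₀
          (by simp) (by simp [Set.insert_subset_iff]) Finset.card_le_four
      have h₁ := step₁.disjoint_of_guards ((guards_segment hb hc (hlq.trans hqb)).mono
        (by simp [Set.insert_subset_iff])) hA₀
      obtain ⟨A₂, step₂, hA₂⟩ := exists_play_move (G := subdividedTree L h) (r := r) (k := 4)
        (X := {a, b, q}) (C := {a, b, p, q}) (C' := {a, b, q}) A₁
          (by simp [Set.insert_subset_iff]) (by simp)
          (Finset.card_le_three.trans (by norm_num))
      refine ⟨_, (hplay.trans (step₁.mono ?_)).trans (step₂.mono ?_), ?_⟩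
      · simp [Set.insert_subset_iff]
      · simp [Set.insert_subset_iff]
      · rw [← hq']
        refine step₂.disjoint_of_guards ((guards_segment hb hc hqb).mono
          (by simp [Set.insert_subset_iff])) fun v hv hv' => ?_
        have hvq := hv'.2
        rw [hq'] at hvq
        rcases List.suffix_cons_iff.1 hvq with e | e
        · exact hA₁ v hv (by simp [show v = q from Subtype.ext (e.trans hq'.symm)])
        · exact h₁ v hv ⟨hv'.1, e⟩
  obtain ⟨A', h1, h2⟩ := key (b.1.length - a.1.length) b (by have := hab.length_le; omega) hab
    List.suffix_rfl
  exact ⟨_, A', le_rfl, by simpa using h1, h2⟩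

/-- The cops move to the ends of an unbranched path, and then clear it. -/
lemma exists_play_clean {c : ℤ} {a b : TreeVertex L h} (hb : UnbranchedAbove c b)
    (hc : c ≤ a.1.length) (hab : a.1 <:+ b.1) (C : Finset (TreeVertex L h))
    (A : Set (TreeVertex L h)) :
    ∃ n A₀ A', n ≤ 2 * (b.1.length - a.1.length) ∧
      Play (subdividedTree L h) r 4 (C ∩ {a, b}) 1 C A {a, b} A₀ ∧
      Play (subdividedTree L h) r 4 {a, b} n {a, b} A₀ {a, b} A' ∧
      ∀ v ∈ A', ¬ (a.1 <:+ v.1 ∧ v.1 <:+ b.1) := by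
  obtain ⟨A₀, h1, h2⟩ := exists_play_move (G := subdividedTree L h) (r := r) (k := 4)
    (X := C ∩ {a, b}) (C := C) (C' := {a, b}) A (by simp) (by simp)
    (Finset.card_le_two.trans (by norm_num))
  obtain ⟨n, A', hn, h3, h4⟩ := exists_play_sweep (r := r) hb hc hab fun ha => h2 a ha (by simp)
  exact ⟨n, A₀, A', hn, h1, h3, h4⟩

/-- Four cops can clear all descendants of `w` within `t` rounds, and end with a cop on `w`,
without guarding `w` in the meantime, if before these rounds the robber is not on an unbranched path
of length at least `m` above `w`. -/
def Clearable (r t m : ℕ) (w : TreeVertex L h) : Prop :=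
  ∀ c : ℤ, UnbranchedAbove c w → c + m ≤ w.1.length →
    ∀ (C : Finset (TreeVertex L h)) (A : Set (TreeVertex L h)),
      (∀ v ∈ A, ¬ (c < meetDepth w.1 v.1 ∧ meetDepth w.1 v.1 < w.1.length)) →
      ∃ n C' A', n ≤ t ∧ Play (subdividedTree L h) r 4 ∅ n C A C' A' ∧ w ∈ C' ∧
        ∀ v ∈ A', ¬ w.1 <:+ v.1

lemma clearable_leaf {t m : ℕ} (ht : 1 ≤ t) {u : List Bool} (hu : u.length = h) :
    Clearable r t m (node L u hu.le) := by
  intro c _ _ C A _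
  obtain ⟨A', h1, h2⟩ := exists_play_move (G := subdividedTree L h) (r := r) (k := 4) (X := ∅)
    (C := C) (C' := {node L u hu.le}) A (by simp) (by simp) (by simp)
  refine ⟨1, _, A', ht, h1, by simp, fun v hv hwv => h2 v hv ?_⟩
  -- the leaf has no descendant other than itself
  obtain ⟨u', hu', hv'⟩ := v.2
  have e : u = u' := (expand_suffix_iff.1 (hwv.trans hv')).eq_of_length_le (by omega)
  subst e
  rw [Finset.mem_singleton]
  exact Subtype.ext (hv'.eq_of_length_le hwv.length_le)

lemma eq_or_cons_suffix {s l : List Bool} (hs : s <:+ l) :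
    l = s ∨ false :: s <:+ l ∨ true :: s <:+ l := by
  obtain ⟨t, rfl⟩ := hs
  rcases List.eq_nil_or_concat t with rfl | ⟨t', d, rfl⟩
  · exact Or.inl rfl
  · right
    cases d
    · exact Or.inl ⟨t', by simp⟩
    · exact Or.inr ⟨t', by simp⟩

/-- A vertex below the first edge of an unbranched path is on this path or below its end. -/
lemma suffix_of_not_mem_segment {w z v : TreeVertex L h} {b : Bool}
    (hz : UnbranchedAbove w.1.length z) (hb : b :: w.1 <:+ z.1) (hv : b :: w.1 <:+ v.1)
    (hseg : ¬ (w.1 <:+ v.1 ∧ v.1 <:+ z.1)) : z.1 <:+ v.1 := by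
  have h1 := (suffix_iff_le_meetDepth v.1 hb).1 hv
  rw [List.length_cons] at h1
  rw [suffix_iff_meetDepth_eq]
  by_contra h2
  have h3 := meetDepth_le z.1 v.1
  exact hseg ⟨(List.suffix_cons _ _).trans hv, hz v (by omega) (by omega)⟩

lemma not_unbranched_meet {w z v : TreeVertex L h} (hwz : w.1 <:+ z.1)
    (hz : UnbranchedAbove w.1.length z) (hseg : ¬ (w.1 <:+ v.1 ∧ v.1 <:+ z.1)) :
    ¬ ((w.1.length : ℤ) < meetDepth z.1 v.1 ∧ meetDepth z.1 v.1 < z.1.length) :=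
  fun hv => hseg ⟨(suffix_iff_le_meetDepth v.1 hwz).2 (by omega), hz v hv.1 hv.2⟩

/-- The recursion of the strategy. To clear the descendants of `w`, the cops clear the path to the
first child and then, without a guard, the descendants of this child. They return to `w` along the
path, and put a guard on `w`. Meanwhile the robber may have left upwards, by less than `ρ`. So the
cops clear the path of length `ρ` above `w`, and then treat the second child like the first one: the
path between `w` and this child is so long that the robber cannot escape to `w` before the cops
return. -/
lemma clearable_node {u : List Bool} {t t' m m' ℓ ρ : ℕ} (hu : u.length + 1 ≤ h)
    (hℓ : L u.length + 1 = ℓ) (hρ : r * (4 * ℓ + 3 + t') < ρ) (hm' : m' ≤ ℓ)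
    (ht' : r * (t' + 1) < ℓ) (ht : 8 * ℓ + 5 + 2 * t' + 2 * ρ ≤ t) (hm : r * t + ρ + 1 ≤ m)
    (h₀ : Clearable r t' m' (node L (false :: u) hu : TreeVertex L h))
    (h₁ : Clearable r t' m' (node L (true :: u) hu : TreeVertex L h)) :
    Clearable r t m (node L u (by omega) : TreeVertex L h) := by
  intro c hc hcm C A hA
  have hun₀ : UnbranchedAbove _ (node L (false :: u) hu : TreeVertex L h) := unbranchedAbove_node hu
  have hun₁ : UnbranchedAbove _ (node L (true :: u) hu : TreeVertex L h) := unbranchedAbove_node hu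
  have hb₀ : false :: (node L u (by omega) : TreeVertex L h).1 <:+
    (node L (false :: u) hu : TreeVertex L h).1 := cons_expand_suffix _ _
  have hb₁ : true :: (node L u (by omega) : TreeVertex L h).1 <:+
    (node L (true :: u) hu : TreeVertex L h).1 := cons_expand_suffix _ _
  have hl₀ : (node L (false :: u) hu : TreeVertex L h).1.length =
    (node L u (by omega) : TreeVertex L h).1.length + ℓ := by
      rw [← hℓ, ← add_assoc]; exact length_expand_cons _ _
  have hl₁ : (node L (true :: u) hu : TreeVertex L h).1.length =
    (node L u (by omega) : TreeVertex L h).1.length + ℓ := by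
      rw [← hℓ, ← add_assoc]; exact length_expand_cons _ _
  change UnbranchedAbove (node L u (by omega) : TreeVertex L h).1.length _ at hun₀ hun₁
  generalize (node L u (by omega) : TreeVertex L h) = w at *
  generalize (node L (false :: u) hu : TreeVertex L h) = w₀ at *
  generalize (node L (true :: u) hu : TreeVertex L h) = w₁ at *
  have hw₀ : w.1 <:+ w₀.1 := (List.suffix_cons _ _).trans hb₀
  have hw₁ : w.1 <:+ w₁.1 := (List.suffix_cons _ _).trans hb₁
  -- the path to the first child
  obtain ⟨n1, B1, A1, hn1, p1, p1', s1⟩ := exists_play_clean (r := r) hun₀ le_rfl hw₀ C A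
  -- the descendants of the first child
  obtain ⟨n2, C2, A2, hn2, p2, hC2, d2⟩ := h₀ _ hun₀ (by omega) {w, w₀} A1 fun v hv =>
    not_unbranched_meet hw₀ hun₀ (s1 v hv)
  -- back to `w`
  obtain ⟨n3, B3, A3, hn3, p3, p3', s3⟩ := exists_play_clean (r := r) hun₀ le_rfl hw₀ C2 A2
  have d3 := p3'.disjoint_of_guards ((guards_descendants w₀).mono (by simp))
    (p3.disjoint_of_guards ((guards_descendants w₀).mono (by simpa using hC2)) d2)
  have k3 : ∀ v ∈ A3, v ∉ {v | v = w ∨ false :: w.1 <:+ v.1} := by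
    rintro v hv (rfl | hv')
    · exact s3 _ hv ⟨List.suffix_rfl, hw₀⟩
    · exact d3 v hv (suffix_of_not_mem_segment hun₀ hb₀ hv' (s3 v hv))
  -- the path above `w`
  let x : TreeVertex L h :=
    ⟨w.1.drop ρ, w.2.imp fun _ hu => ⟨hu.1, (List.drop_suffix _ _).trans hu.2⟩⟩
  have hxl : x.1.length = w.1.length - ρ := List.length_drop
  have hxw : x.1 <:+ w.1 := List.drop_suffix _ _
  clear_value x
  obtain ⟨n4, B4, A4, hn4, p4, p4', s4⟩ :=
    exists_play_clean (r := r) hc (by omega) hxw {w, w₀} A3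
  have k4 := p4'.disjoint_of_guards ((guards_child w false).mono (by simp))
    (p4.disjoint_of_guards ((guards_child w false).mono (by simp)) k3)
  obtain ⟨N, hN, q4⟩ : ∃ N, N ≤ 4 * ℓ + 3 + t' ∧
      Play (subdividedTree L h) r 4 ∅ N C A {x, w} B4 :=
    ⟨_, by omega, (((((p1.mono (Set.empty_subset _)).trans (p1'.mono (Set.empty_subset _))).trans
      p2).trans (p3.mono (Set.empty_subset _))).trans (p3'.mono (Set.empty_subset _))).trans
      (p4.mono (Set.empty_subset _))⟩
  have hrN := Nat.mul_le_mul_left r hN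
  have f4 : ∀ v ∈ B4, ¬ x.1 <:+ v.1 → (meetDepth w.1 v.1 : ℤ) ≤ c + r * N := by
    intro v hv hxv
    obtain ⟨a, ha, -, p, hp⟩ := q4.exists_walk guards_univ hv (Set.mem_univ v)
    have hav := meetDepth_le_of_walk w.1 p
    have hav' := hA a ha
    rw [suffix_iff_le_meetDepth v.1 hxw] at hxv
    have : ((r * N : ℕ) : ℤ) = r * N := by push_cast; rfl
    omega
  have f4' : ∀ v ∈ A4, ¬ w.1 <:+ v.1 → (meetDepth w.1 v.1 : ℤ) ≤ c + r * N + r * n4 := by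
    intro v hv hwv
    have e1 : ((r * N : ℕ) : ℤ) = r * N := by push_cast; rfl
    have e2 : ((r * n4 : ℕ) : ℤ) = r * n4 := by push_cast; rfl
    by_cases hxv : x.1 <:+ v.1
    · by_contra hlt
      rw [suffix_iff_meetDepth_eq] at hwv
      have := meetDepth_le w.1 v.1
      exact s4 v hv ⟨hxv, hc v (by omega) (by omega)⟩
    · obtain ⟨a, ha, hxa, p, hp⟩ := p4'.exists_walk
        ((guards_descendants x).compl.mono (by simp)) hv hxv
      have hav := meetDepth_le_of_walk w.1 p
      have := f4 a ha hxa
      omega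
  -- the path to the second child
  obtain ⟨n5, B5, A5, hn5, p5, p5', s5⟩ := exists_play_clean (r := r) hun₁ le_rfl hw₁ {x, w} A4
  have q5 : Play (subdividedTree L h) r 4 {w} (1 + n5) {x, w} A4 {w, w₁} A5 :=
    (p5.mono (by simp)).trans (p5'.mono (by simp))
  have k5 := q5.disjoint_of_guards (guards_child w false) k4
  have f5 : ∀ v ∈ A5, ¬ w.1 <:+ v.1 →
      (meetDepth w.1 v.1 : ℤ) ≤ c + r * N + r * n4 + r * (1 + n5 : ℕ) := by
    intro v hv hwv
    obtain ⟨a, ha, hwa, p, hp⟩ := q5.exists_walk (guards_descendants w).compl hv hwv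
    have hav := meetDepth_le_of_walk w.1 p
    have := f4' a ha hwa
    have : ((r * (1 + n5) : ℕ) : ℤ) = r * (1 + n5 : ℕ) := by push_cast; rfl
    omega
  -- the descendants of the second child
  obtain ⟨n6, C6, A6, hn6, p6, hC6, d6⟩ := h₁ _ hun₁ (by omega) {w, w₁} A5 fun v hv =>
    not_unbranched_meet hw₁ hun₁ (s5 v hv)
  -- back to `w`
  obtain ⟨n7, B7, A7, hn7, p7, p7', s7⟩ := exists_play_clean (r := r) hun₁ le_rfl hw₁ C6 A6
  have d7 := p7'.disjoint_of_guards ((guards_descendants w₁).mono (by simp))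
    (p7.disjoint_of_guards ((guards_descendants w₁).mono (by simpa using hC6)) d6)
  have q7 : Play (subdividedTree L h) r 4 ∅ (n6 + 1) {w, w₁} A5 {w, w₁} B7 :=
    p6.trans (p7.mono (Set.empty_subset _))
  have hr7 : r * (n6 + 1) ≤ r * (t' + 1) := Nat.mul_le_mul_left r (by omega)
  -- before the guard is back on `w`, the robber has come neither from above nor from below
  have k7 : ∀ v ∈ B7, v ∉ {v | v = w ∨ false :: w.1 <:+ v.1} := by
    intro v hv hvK
    obtain ⟨a, ha, -, p, hp⟩ := q7.exists_walk guards_univ hv (Set.mem_univ v)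
    have hwv : w.1 <:+ v.1 := by
      rcases hvK with rfl | hvK
      exacts [List.suffix_rfl, (List.suffix_cons _ _).trans hvK]
    by_cases hwa : w.1 <:+ a.1
    · have hda : w₁.1 <:+ a.1 := by
        rcases eq_or_cons_suffix hwa with e | e | e
        · exact absurd (Or.inl (Subtype.ext e)) (k5 a ha)
        · exact absurd (Or.inr e) (k5 a ha)
        · exact suffix_of_not_mem_segment hun₁ hb₁ e (s5 a ha)
      have hmv : meetDepth w₁.1 v.1 ≤ w.1.length := by
        rcases hvK with rfl | hvK
        · exact meetDepth_le_right _ _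
        · by_contra! hlt
          have := (suffix_iff_le_meetDepth v.1 hb₁).2 (by simpa using hlt)
          have := (List.suffix_of_suffix_length_le hvK this (by simp)).eq_of_length (by simp)
          simp at this
      have := (meetDepth_le_of_walk w₁.1 p).1
      rw [suffix_iff_meetDepth_eq.1 hda] at this
      omega
    · have hav := (meetDepth_le_of_walk w.1 p).2
      rw [suffix_iff_meetDepth_eq.1 hwv] at hav
      have h5 := f5 a ha hwa
      have htot : N + n4 + (1 + n5) + (n6 + 1) ≤ t := by omega
      have hrt := Nat.mul_le_mul_left r htot
      rw [Nat.mul_add, Nat.mul_add, Nat.mul_add] at hrt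
      have : (((r * N + r * n4 + r * (1 + n5) : ℕ)) : ℤ) =
        r * N + r * n4 + r * (1 + n5 : ℕ) := by push_cast; rfl
      omega
  have k7' := p7'.disjoint_of_guards ((guards_child w false).mono (by simp)) k7
  refine ⟨_, _, A7, ?_, ((((q4.trans (p4'.mono (Set.empty_subset _))).trans
    (q5.mono (Set.empty_subset _))).trans q7).trans (p7'.mono (Set.empty_subset _))),
    by simp, fun v hv hwv => ?_⟩
  · omega
  · rcases eq_or_cons_suffix hwv with e | e | e
    · exact k7' v hv (Or.inl (Subtype.ext e))
    · exact k7' v hv (Or.inr e)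
    · exact d7 v hv (suffix_of_not_mem_segment hun₁ hb₁ e (s7 v hv))

/-- If the paths of the subdivision are long enough, depending on the height and on the bound `R` on
the speed of the robber, then four cops suffice. -/
theorem exists_subdivision_strategy (R h : ℕ) : ∃ L : ℕ → ℕ, ∀ r ≤ R,
    ∃ C : ℕ → Finset (TreeVertex L h), (∀ i, (C i).card ≤ 4) ∧
      ∃ m, copTerritory (subdividedTree L h) r C m = ∅ := by
  -- for nodes whose subtree has height `g`: the number `t g` of rounds, the length `ρ g` of the path
  -- above the node that is cleared, and the length `ℓ g` of the paths to such nodes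
  obtain ⟨t, ρ, ℓ, ht0, hℓ, hρ, ht⟩ : ∃ t ρ ℓ : ℕ → ℕ, 1 ≤ t 0 ∧
      (∀ g, ℓ g = R * t g + ρ g + 1 + R + 1) ∧
      (∀ g, ρ (g + 1) = R * (4 * ℓ g + 3 + t g) + 1) ∧
      (∀ g, t (g + 1) = 8 * ℓ g + 5 + 2 * t g + 2 * ρ (g + 1)) := by
    let F : ℕ × ℕ → ℕ × ℕ := fun p =>
      (8 * (R * p.1 + p.2 + 1 + R + 1) + 5 + 2 * p.1 +
        2 * (R * (4 * (R * p.1 + p.2 + 1 + R + 1) + 3 + p.1) + 1),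
        R * (4 * (R * p.1 + p.2 + 1 + R + 1) + 3 + p.1) + 1)
    let P : ℕ → ℕ × ℕ := fun g => F^[g] (1, 0)
    have hP : ∀ g, P (g + 1) = F (P g) := fun g => Function.iterate_succ_apply' F g _
    exact ⟨fun g => (P g).1, fun g => (P g).2, fun g => R * (P g).1 + (P g).2 + 1 + R + 1, le_rfl,
      fun _ => rfl, fun g => by simp only [hP]; rfl, fun g => by simp only [hP]; rfl⟩
  refine ⟨fun k => ℓ (h - 1 - k) - 1, fun r hr => ?_⟩
  have key : ∀ g (u : List Bool) (hu : u.length + g = h), Clearable r (t g) (R * t g + ρ g + 1)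
      (node (fun k => ℓ (h - 1 - k) - 1) u (by omega) : TreeVertex _ h) := by
    intro g
    induction g with
    | zero => exact fun u hu => clearable_leaf ht0 hu
    | succ g ih =>
      intro u hu
      have hRt := Nat.mul_add_one R (t g)
      refine clearable_node (t' := t g) (m' := R * t g + ρ g + 1) (ℓ := ℓ g) (ρ := ρ (g + 1))
        (by omega) ?_ ?_ ?_ ?_ (ht g).ge ?_ (ih _ (by simp; omega)) (ih _ (by simp; omega))
      · rw [show h - 1 - u.length = g by omega]
        have := hℓ g
        omega
      · have := hρ g
        have := Nat.mul_le_mul_right (4 * ℓ g + 3 + t g) hr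
        omega
      · have := hℓ g; omega
      · have := Nat.mul_le_mul_right (t g + 1) hr
        have := hℓ g
        omega
      · have := Nat.mul_le_mul_right (t (g + 1)) hr
        omega
  -- nothing is above the root, so that any negative number is a bound on the depths there
  obtain ⟨n, C', A', -, hplay, -, hA'⟩ := key h [] (by simp) (-(R * t h + ρ h + 1 : ℕ))
    (fun v _ hv => absurd hv (Nat.not_lt_zero _))
    (by rw [neg_add_cancel]; exact Int.natCast_nonneg _) ∅ Set.univ
    (fun v _ hv => absurd hv.2 (Nat.not_lt_zero _))
  obtain ⟨D, h1, -, h3⟩ := hplay.exists_strategy (by simp) (by simp)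
  exact ⟨D, h1, n, h3.trans (Set.eq_empty_of_forall_notMem fun v hv => hA' v hv List.nil_suffix)⟩

end CopStrategy

/-! ### Large bags in decompositions of subdivided binary trees -/

section Bags

variable {V ι : Type*} [LinearOrder ι] {bag : ι → Set V} {L : ℕ → ℕ} {h : ℕ}

/-- In a linear decomposition, a walk from one bag to another meets every bag between them. -/
lemma exists_mem_support_mem_bag {G : SimpleGraph V}
    (hedge : ∀ u v, G.Adj u v → ∃ i, u ∈ bag i ∧ v ∈ bag i)
    (hconn : ∀ v, {i | v ∈ bag i}.OrdConnected) {a b : V} (p : G.Walk a b) {i j l : ι}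
    (ha : a ∈ bag i) (hb : b ∈ bag j) (hil : i ≤ l) (hlj : l ≤ j) :
    ∃ x ∈ p.support, x ∈ bag l := by
  induction p generalizing i with
  | nil => exact ⟨_, by simp, (hconn _).out ha hb ⟨hil, hlj⟩⟩
  | cons hadj p ih =>
    obtain ⟨q, hq, hq'⟩ := hedge _ _ hadj
    rcases le_total l q with hlq | hql
    · exact ⟨_, by simp, (hconn _).out ha hq ⟨hil, hlq⟩⟩
    · obtain ⟨x, hx, hxl⟩ := ih hq' hb hql
      exact ⟨x, by simp [hx], hxl⟩

/-- Of three disjoint subtrees below a node, with a large bag each, the one whose large bag is in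
the middle can be used to find a larger bag: this bag also contains a vertex of the connection
between the other two subtrees. -/
lemma le_encard_bag_of_three_subtrees {bag : ι → Set (TreeVertex L h)}
    (hedge : ∀ u v, (subdividedTree L h).Adj u v → ∃ i, u ∈ bag i ∧ v ∈ bag i)
    (hconn : ∀ v, {i | v ∈ bag i}.OrdConnected) {u a b c : List Bool} (hu : u.length ≤ h)
    (ha : u <:+ a) (hb : u <:+ b) (hc : u <:+ c) (hab : a.length = b.length)
    (hcb : c.length = b.length) (hab' : a ≠ b) (hcb' : c ≠ b) {i j l : ι} (hij : i ≤ j)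
    (hjl : j ≤ l) {m : ℕ}
    (hi : (m + 1 : ℕ) ≤ (bag i ∩ {v | expand L a <:+ v.1}).encard)
    (hj : (m + 1 : ℕ) ≤ (bag j ∩ {v | expand L b <:+ v.1}).encard)
    (hl : (m + 1 : ℕ) ≤ (bag l ∩ {v | expand L c <:+ v.1}).encard) :
    (m + 1 + 1 : ℕ) ≤ (bag j ∩ {v | expand L u <:+ v.1}).encard := by
  have hne : ∀ {s : Set (TreeVertex L h)}, (m + 1 : ℕ) ≤ s.encard → s.Nonempty := by
    intro s hs
    by_contra h0
    rw [Set.not_nonempty_iff_eq_empty.1 h0, Set.encard_empty] at hs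
    exact absurd hs (by simp)
  obtain ⟨y, hy, hya⟩ := hne hi
  obtain ⟨z, hz, hzc⟩ := hne hl
  have hya : expand L a <:+ y.1 := hya
  have hzc : expand L c <:+ z.1 := hzc
  obtain ⟨p, -, hp, -⟩ := exists_walk_to_ancestor y (node L u hu)
    ((expand_suffix_expand ha).trans hya)
  obtain ⟨q, -, hq, -⟩ := exists_walk_to_ancestor z (node L u hu)
    ((expand_suffix_expand hc).trans hzc)
  obtain ⟨x, hx, hxj⟩ := exists_mem_support_mem_bag hedge hconn (p.append q.reverse) hy hz hij hjl
  have hdisj : ∀ {d : List Bool} {w : TreeVertex L h}, d.length = b.length → d ≠ b →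
      expand L d <:+ w.1 → x.1 <:+ w.1 → ¬ expand L b <:+ x.1 := by
    intro d w hdl hdb hdw hxw hbx
    have hle := length_expand_eq (L := L) hdl
    exact hdb (expand_injective
      ((List.suffix_of_suffix_length_le hdw (hbx.trans hxw) hle.le).eq_of_length hle))
  have hx' : expand L u <:+ x.1 ∧ ¬ expand L b <:+ x.1 := by
    rw [SimpleGraph.Walk.mem_support_append_iff, SimpleGraph.Walk.support_reverse,
      List.mem_reverse, hp, hq] at hx
    rcases hx with hx | hx
    · exact ⟨hx.1, hdisj hab hab' hya hx.2⟩
    · exact ⟨hx.1, hdisj hcb hcb' hzc hx.2⟩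
  calc ((m + 1 + 1 : ℕ) : ℕ∞) = (m + 1 : ℕ) + 1 := by push_cast; rfl
    _ ≤ (bag j ∩ {v | expand L b <:+ v.1}).encard + 1 := by gcongr
    _ = (insert x (bag j ∩ {v | expand L b <:+ v.1})).encard :=
      (Set.encard_insert_of_notMem fun h' => hx'.2 h'.2).symm
    _ ≤ _ := by
      refine Set.encard_le_encard (Set.insert_subset ⟨hxj, hx'.1⟩ ?_)
      exact Set.inter_subset_inter_right _ fun v hv => (expand_suffix_expand hb).trans hv

/-- Every linear decomposition of the subdivided tree has a bag with more than `m` vertices below a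
node, if the height of the subtree there is at least `2 * m`. -/
theorem exists_le_encard_bag {bag : ι → Set (TreeVertex L h)}
    (hvert : ∀ v, ∃ i, v ∈ bag i)
    (hedge : ∀ u v, (subdividedTree L h).Adj u v → ∃ i, u ∈ bag i ∧ v ∈ bag i)
    (hconn : ∀ v, {i | v ∈ bag i}.OrdConnected) (m : ℕ) (u : List Bool)
    (hu : u.length + 2 * m ≤ h) :
    ∃ i, (m + 1 : ℕ) ≤ (bag i ∩ {v | expand L u <:+ v.1}).encard := by
  induction m generalizing u with
  | zero =>
    obtain ⟨i, hi⟩ := hvert (node L u (by omega))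
    refine ⟨i, ?_⟩
    rw [zero_add, Nat.cast_one, Set.one_le_encard_iff_nonempty]
    exact ⟨node L u (by omega), hi, List.suffix_rfl⟩
  | succ m ih =>
    have suf : ∀ b c, u <:+ b :: c :: u := fun b c =>
      (List.suffix_cons c u).trans (List.suffix_cons b _)
    have hlen' : ∀ b c : Bool, (b :: c :: u).length + 2 * m ≤ h := fun b c => by simp; omega
    obtain ⟨i, hi⟩ := ih (false :: false :: u) (hlen' _ _)
    obtain ⟨j, hj⟩ := ih (false :: true :: u) (hlen' _ _)
    obtain ⟨l, hl⟩ := ih (true :: false :: u) (hlen' _ _)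
    have core : ∀ {b c b' c' b'' c'' : Bool} {i j l : ι}, i ≤ j → j ≤ l →
        (m + 1 : ℕ) ≤ (bag i ∩ {v | expand L (b :: c :: u) <:+ v.1}).encard →
        (m + 1 : ℕ) ≤ (bag j ∩ {v | expand L (b' :: c' :: u) <:+ v.1}).encard →
        (m + 1 : ℕ) ≤ (bag l ∩ {v | expand L (b'' :: c'' :: u) <:+ v.1}).encard →
        (b, c) ≠ (b', c') → (b'', c'') ≠ (b', c') →
        ∃ i, (m + 1 + 1 : ℕ) ≤ (bag i ∩ {v | expand L u <:+ v.1}).encard := by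
      intro b c b' c' b'' c'' i j l hij hjl hi hj hl h1 h2
      exact ⟨j, le_encard_bag_of_three_subtrees hedge hconn (by omega) (suf b c) (suf b' c')
        (suf b'' c'') rfl rfl (by simpa using h1) (by simpa using h2) hij hjl hi hj hl⟩
    rcases le_total i j with hij | hij <;> rcases le_total j l with hjl | hjl <;>
      rcases le_total i l with hil | hil
    · exact core hij hjl hi hj hl (by simp) (by simp)
    · exact core hij hjl hi hj hl (by simp) (by simp)
    · exact core hil hjl hi hl hj (by simp) (by simp)
    · exact core hil hij hl hi hj (by simp) (by simp)
    · exact core hij hil hj hi hl (by simp) (by simp)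
    · exact core hjl hil hj hl hi (by simp) (by simp)
    · exact core hjl hij hl hj hi (by simp) (by simp)
    · exact core hjl hij hl hj hi (by simp) (by simp)

end Bags

/-! ### Linear clique-width of subcubic graphs -/

section LinearCliqueWidth

variable {V : Type*} {k : ℕ}

lemma LinearlyBuilt.mem_of_adj {S : Set V} {H : SimpleGraph V} {lab : V → Fin k}
    (hb : LinearlyBuilt k S H lab) : ∀ u v, H.Adj u v → u ∈ S := by
  induction hb with
  | empty => exact fun u v h => absurd h (by simp)
  | addVertex v i hv _ ih => exact fun u w h => Or.inr (ih u w h)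
  | join i j hij _ ih =>
    rintro u v (h | h)
    · exact ih u v h
    · rcases ((SimpleGraph.fromRel_adj _ _ _).1 h).2 with h | h
      · exact h.1
      · exact h.2.1
  | relabel i j _ ih => exact ih

/-- The edges of `H` lie in `S`, and those of `J` are still to be added, so that vertices of `S` with
the same label have the same neighbours in `J`, and all neighbours outside `S` are of this kind. So
in a subcubic graph at most three vertices with a given label have neighbours outside `S`. -/
lemma encard_boundary_le [Finite V] {G H J : SimpleGraph V} (hG : IsSubcubic G) {S : Set V}
    {lab : V → Fin k} (hGJ : ∀ u v, G.Adj u v ↔ H.Adj u v ∨ J.Adj u v)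
    (hH : ∀ u v, H.Adj u v → u ∈ S)
    (hJ : ∀ u ∈ S, ∀ v ∈ S, lab u = lab v → ∀ x, J.Adj u x → J.Adj v x) :
    {u | u ∈ S ∧ ∃ x, x ∉ S ∧ G.Adj u x}.encard ≤ (3 * k : ℕ) := by
  classical
  have : Fintype V := Fintype.ofFinite V
  set B := {u | u ∈ S ∧ ∃ x, x ∉ S ∧ G.Adj u x} with hB
  have key : ∀ c ∈ B.toFinset.image lab, (B.toFinset.filter fun u => lab u = c).card ≤ 3 := by
    intro c hc
    obtain ⟨u, hu, rfl⟩ := Finset.mem_image.1 hc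
    rw [Set.mem_toFinset] at hu
    obtain ⟨huS, x, hxS, hux⟩ := hu
    have hJux : J.Adj u x := ((hGJ u x).1 hux).resolve_left fun h' => hxS (hH x u h'.symm)
    have h1 := (Set.encard_le_encard (fun v hv => ?_ :
      ((B.toFinset.filter fun v => lab v = lab u : Finset V) : Set V) ⊆ G.neighborSet x)).trans
      (hG x)
    · rw [Set.encard_coe_eq_coe_finsetCard] at h1
      exact_mod_cast h1
    · rw [Finset.mem_coe, Finset.mem_filter, Set.mem_toFinset] at hv
      exact ((hGJ v x).2 (Or.inr (hJ u huS v hv.1.1 hv.2.symm x hJux))).symm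
  have h1 := Finset.card_le_mul_card_image B.toFinset 3 key
  have h2 : (B.toFinset.image lab).card ≤ k := (Finset.card_le_univ _).trans (by simp)
  rw [← Set.coe_toFinset B, Set.encard_coe_eq_coe_finsetCard]
  exact_mod_cast h1.trans (Nat.mul_le_mul_left 3 h2)

/-- If the vertices of a subcubic graph are numbered in the order in which they are added in a linear
construction with `k` labels, then at every time at most `3 * k` of the previous vertices have a
neighbour that is added later. Here `J` consists of the edges that are still to be added to `H`. -/
lemma LinearlyBuilt.exists_numbering [Finite V] {G : SimpleGraph V} (hG : IsSubcubic G)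
    {S : Set V} {H : SimpleGraph V} {lab : V → Fin k} (hb : LinearlyBuilt k S H lab) :
    ∀ J : SimpleGraph V, (∀ u v, G.Adj u v ↔ H.Adj u v ∨ J.Adj u v) →
      (∀ u ∈ S, ∀ v ∈ S, lab u = lab v → ∀ x, J.Adj u x → J.Adj v x) →
      ∃ (num : V → ℕ) (N : ℕ), Set.InjOn num S ∧ (∀ v ∈ S, num v < N) ∧
        ∀ i, {v | v ∈ S ∧ num v < i ∧ ∃ x, G.Adj v x ∧ (x ∉ S ∨ i ≤ num x)}.encard ≤
          (3 * k : ℕ) := by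
  classical
  induction hb with
  | empty => exact fun _ _ _ => ⟨fun _ => 0, 0, by simp⟩
  | @addVertex S H lab v c hv hb ih =>
    intro J hGJ hJ
    have hne : ∀ u ∈ S, u ≠ v := fun u hu e => hv (e ▸ hu)
    obtain ⟨num, N, hinj, hlt, hle⟩ := ih J hGJ fun u hu w hw huw x hux =>
      hJ u (Or.inr hu) w (Or.inr hw) (by
        rw [Function.update_of_ne (hne u hu), Function.update_of_ne (hne w hw), huw]) x hux
    have hnum : ∀ u ∈ S, Function.update num v N u = num u := fun u hu =>
      Function.update_of_ne (hne u hu) _ _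
    refine ⟨Function.update num v N, N + 1, ?_, ?_, fun i => ?_⟩
    · rintro a (rfl | ha) b (rfl | hb') hab
      · rfl
      · rw [Function.update_self, hnum b hb'] at hab
        exact absurd (hlt b hb') (by omega)
      · rw [Function.update_self, hnum a ha] at hab
        exact absurd (hlt a ha) (by omega)
      · rw [hnum a ha, hnum b hb'] at hab
        exact hinj ha hb' hab
    · rintro a (rfl | ha)
      · simp
      · rw [hnum a ha]
        exact (hlt a ha).trans (Nat.lt_succ_self N)
    · rcases le_or_gt i N with hi | hi
      · refine (Set.encard_le_encard ?_).trans (hle i)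
        rintro u ⟨rfl | hu, hui, x, hux, hx⟩
        · rw [Function.update_self] at hui
          omega
        · rw [hnum u hu] at hui
          refine ⟨hu, hui, x, hux, ?_⟩
          by_cases hxS : x ∈ S
          · rw [hnum x hxS] at hx
            exact Or.inr (hx.resolve_left fun h => h (Or.inr hxS))
          · exact Or.inl hxS
      · refine (Set.encard_le_encard ?_).trans
          (encard_boundary_le hG hGJ (hb.addVertex v c hv).mem_of_adj hJ)
        rintro u ⟨hu, -, x, hux, hx⟩
        refine ⟨hu, x, fun hxS => ?_, hux⟩
        have hix := hx.resolve_left fun h => h hxS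
        rcases hxS with rfl | hxS
        · rw [Function.update_self] at hix
          omega
        · rw [hnum x hxS] at hix
          have := hlt x hxS
          omega
  | @join S H lab i j hij hb ih =>
    intro J hGJ hJ
    refine ih (joinEdges S lab i j ⊔ J) (fun u v => ?_) fun u hu v hv huv x => ?_
    · rw [hGJ, SimpleGraph.sup_adj, SimpleGraph.sup_adj, or_assoc]
    · rintro (h | h)
      · refine Or.inl ?_
        simp only [joinEdges, SimpleGraph.fromRel_adj] at h ⊢
        rw [huv] at h
        refine ⟨?_, ?_⟩
        · rintro rfl
          rcases h.2 with h | h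
          · exact hij (h.2.2.1.symm.trans h.2.2.2)
          · exact hij (h.2.2.1.symm.trans h.2.2.2)
        · tauto
      · exact Or.inr (hJ u hu v hv huv x h)
  | @relabel S H lab i j hb ih =>
    intro J hGJ hJ
    exact ih J hGJ fun u hu v hv huv => hJ u hu v hv (by simp only [huv])

/-- A subcubic graph that is built linearly with `k` labels has a linear decomposition with bags of
size at most `3 * k + 1`. -/
lemma LinearlyBuilt.exists_bags [Finite V] {G : SimpleGraph V} (hG : IsSubcubic G)
    {lab : V → Fin k} (hb : LinearlyBuilt k Set.univ G lab) :
    ∃ bag : ℕ → Set V, (∀ v, ∃ i, v ∈ bag i) ∧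
      (∀ u v, G.Adj u v → ∃ i, u ∈ bag i ∧ v ∈ bag i) ∧
      (∀ v, {i | v ∈ bag i}.OrdConnected) ∧ ∀ i, (bag i).encard ≤ (3 * k + 1 : ℕ) := by
  obtain ⟨num, N, hinj, -, hle⟩ := hb.exists_numbering hG ⊥ (by simp) (by simp)
  have hedge : ∀ u v, G.Adj u v → num u ≤ num v → ∃ i,
      (num u ≤ i ∧ (num u = i ∨ ∃ x, G.Adj u x ∧ i ≤ num x)) ∧
      (num v ≤ i ∧ (num v = i ∨ ∃ x, G.Adj v x ∧ i ≤ num x)) := fun u v huv hle =>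
    ⟨num v, ⟨hle, Or.inr ⟨v, huv, le_rfl⟩⟩, le_rfl, Or.inl rfl⟩
  refine ⟨fun i => {v | num v ≤ i ∧ (num v = i ∨ ∃ x, G.Adj v x ∧ i ≤ num x)},
    fun v => ⟨num v, le_rfl, Or.inl rfl⟩, fun u v huv => ?_, fun v => ⟨?_⟩, fun i => ?_⟩
  · rcases le_total (num u) (num v) with h | h
    · exact hedge u v huv h
    · exact (hedge v u huv.symm h).imp fun _ h => h.symm
  · rintro i ⟨hi, -⟩ j ⟨-, hj⟩ l ⟨hil, hlj⟩
    refine ⟨hi.trans hil, ?_⟩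
    rcases hj with hj | ⟨x, hx, hj⟩
    · exact Or.inl (by omega)
    · exact Or.inr ⟨x, hx, hlj.trans hj⟩
  · have h1 : {v | num v = i}.encard ≤ 1 := Set.encard_le_one_iff.2 fun a b ha hb' =>
      hinj (Set.mem_univ a) (Set.mem_univ b) (Eq.trans ha (Eq.symm hb'))
    calc _ ≤ ({v | v ∈ Set.univ ∧ num v < i ∧ ∃ x, G.Adj v x ∧ (x ∉ Set.univ ∨ i ≤ num x)} ∪
          {v | num v = i}).encard := by
          refine Set.encard_le_encard ?_
          rintro v ⟨hv, h⟩
          rcases hv.eq_or_lt with hv | hv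
          · exact Or.inr hv
          · obtain ⟨x, hx, hix⟩ := h.resolve_left hv.ne
            exact Or.inl ⟨Set.mem_univ v, hv, x, hx, Or.inr hix⟩
      _ ≤ (3 * k : ℕ) + 1 := (Set.encard_union_le _ _).trans (add_le_add (hle i) h1)
      _ = (3 * k + 1 : ℕ) := by push_cast; rfl

end LinearCliqueWidth

/-! ### The class of graphs -/

lemma exists_le_of_iInf_le {P : ℕ → Prop} {n : ℕ}
    (h : ⨅ (k : ℕ) (_ : P k), (k : ℕ∞) ≤ (n : ℕ∞)) : ∃ k ≤ n, P k := by
  by_contra! hP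
  have : ((n + 1 : ℕ) : ℕ∞) ≤ ⨅ (k : ℕ) (_ : P k), (k : ℕ∞) :=
    le_iInf₂ fun k hk => by
      have := mt (hP k) (not_not.2 hk)
      exact_mod_cast not_le.1 this
  have := this.trans h
  norm_cast at this
  omega

lemma lt_pathwidth_subdividedTree (L : ℕ → ℕ) (m : ℕ) :
    m < pathwidth (subdividedTree L (2 * (m + 1))) := by
  by_contra! h
  obtain ⟨w, hw, D, hD⟩ := exists_le_of_iInf_le h
  obtain ⟨i, hi⟩ := exists_le_encard_bag (L := L) (h := 2 * (m + 1))
    (bag := fun i => (D.bag i : Set (TreeVertex L (2 * (m + 1)))))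
    D.cover_vertex D.cover_edge D.connected (m + 1) [] (by simp)
  have := hi.trans (Set.encard_le_encard Set.inter_subset_left)
  rw [Set.encard_coe_eq_coe_finsetCard] at this
  have := this.trans (Nat.cast_le.2 (hD i))
  norm_cast at this
  omega

lemma lt_linearCliqueWidth_subdividedTree (L : ℕ → ℕ) (m : ℕ) :
    m < linearCliqueWidth (subdividedTree L (2 * (3 * m + 1))) := by
  by_contra! h
  obtain ⟨k, hk, lab, hb⟩ := exists_le_of_iInf_le h
  obtain ⟨bag, h1, h2, h3, h4⟩ := hb.exists_bags isSubcubic_subdividedTree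
  obtain ⟨i, hi⟩ := exists_le_encard_bag h1 h2 h3 (3 * m + 1) [] (by simp)
  have := (hi.trans (Set.encard_le_encard Set.inter_subset_left)).trans (h4 i)
  norm_cast at this
  omega

end BlindPursuit

theorem mainTheorem6 :
    (∃ 𝒞 : Set BlindPursuit.FinGraph,
      (∀ G ∈ 𝒞, G.graph.IsTree ∧ BlindPursuit.IsSubcubic G.graph ∧
        ∃ h : ℕ, BlindPursuit.IsSubdivision G.graph (BlindPursuit.completeBinaryTree h)) ∧
      BlindPursuit.BoundedBlindCopWidth 𝒞 ∧
      ¬ BlindPursuit.BoundedPathwidth 𝒞 ∧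
      BlindPursuit.BoundedBlindFlipWidth 𝒞 ∧
      ¬ BlindPursuit.BoundedLinearCliqueWidth 𝒞) ∧
    ¬ BlindPursuit.TorunczykConjecture := by
  suffices H : _ from ⟨H, fun hconj => by
    obtain ⟨𝒞, -, -, -, hflip, hlin⟩ := H
    exact hlin ((hconj 𝒞).1 hflip)⟩
  choose L hL using fun n => BlindPursuit.exists_subdivision_strategy n n
  let T : ℕ → BlindPursuit.FinGraph := fun n =>
    { V := BlindPursuit.TreeVertex (L n) n
      fintypeV := Fintype.ofFinite _
      graph := BlindPursuit.subdividedTree (L n) n }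
  have hstrat : ∀ r, ∃ k, ∀ n, ∃ C : ℕ → Finset (T n).V, (∀ i, (C i).card ≤ k) ∧
      ∃ m, BlindPursuit.copTerritory (T n).graph r C m = ∅ := by
    intro r
    refine ⟨max 4 ((Finset.range r).sup fun n => @Fintype.card (T n).V (T n).fintypeV),
      fun n => ?_⟩
    rcases le_or_gt r n with hrn | hrn
    · obtain ⟨C, hC, m, hm⟩ := hL n r hrn
      exact ⟨C, fun i => (hC i).trans (le_max_left _ _), m, hm⟩
    · -- only finitely many trees are left, and the cops can occupy all their vertices
      let _ := (T n).fintypeV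
      refine ⟨fun _ => Finset.univ, fun _ => le_max_of_le_right ?_, 0, by
        simp [BlindPursuit.copTerritory]⟩
      exact Finset.le_sup (f := fun n => @Fintype.card (T n).V (T n).fintypeV)
        (Finset.mem_range.2 hrn)
  choose f hf using hstrat
  refine ⟨Set.range T, ?_, ⟨f, ?_⟩, ?_, ⟨fun r => f r + 2 ^ f r, ?_⟩, ?_⟩
  · rintro _ ⟨n, rfl⟩
    exact ⟨BlindPursuit.isTree_subdividedTree, BlindPursuit.isSubcubic_subdividedTree, n,
      BlindPursuit.isSubdivision_subdividedTree⟩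
  · rintro r _ ⟨n, rfl⟩
    exact iInf₂_le (f r) (hf r n)
  · rintro ⟨k, hk⟩
    exact (BlindPursuit.lt_pathwidth_subdividedTree _ k).not_ge (hk _ ⟨2 * (k + 1), rfl⟩)
  · rintro r _ ⟨n, rfl⟩
    obtain ⟨C, hC, m, hm⟩ := hf r n
    exact iInf₂_le (f r + 2 ^ f r) (BlindPursuit.exists_flip_strategy hC hm)
  · rintro ⟨k, hk⟩
    exact (BlindPursuit.lt_linearCliqueWidth_subdividedTree _ k).not_ge
      (hk _ ⟨2 * (3 * k + 1), rfl⟩)
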